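/- For a compactly supported probability measure $m$ on $\mathbb{R}$ let $M_k(m)=\int_{\mathbb R}x^k\,m(dx)$ be its moments, let $S_m(z)=\sum_{k\ge 0}M_k(m)z^{k+1}$ be the formal moment series, let $S_m^{(-1)}(z)$ be its inverse under composition, and put, as formal Laurent series, $$R_m(z)=\frac{1}{S_m^{(-1)}(z)}-\frac1z,\qquad R_m^{\mathrm{quant}}(z)=\frac{1}{S_m^{(-1)}(z)}-\frac{1}{1-e^{-z}} .$$ The free convolution $\mu\boxplus\nu$ of compactly supported probability measures $\mu,\nu$ is the compactly supported probability measure with $R_{\mu\boxplus\nu}=R_\mu+R_\nu$. Let $\mathcal{B}$ be the set of probability measures on $\mathbb{R}$ which have compact support and are absolutely continuous with respect to the Lebesgue measure, with density at most $1$ almost everywhere. The quantized free convolution $\rho_1\otimes\rho_2$ of $\rho_1,\rho_2\in\mathcal{B}$ is the measure in $\mathcal{B}$ with $R^{\mathrm{quant}}_{\rho_1\otimes\rho_2}=R^{\mathrm{quant}}_{\rho_1}+R^{\mathrm{quant}}_{\rho_2}$. **Theorem 1.9.** For every $\rho\in\mathcal{B}$ there exists a compactly supported probability measure $Q(\rho)$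 on $\mathbb{R}$ such that, as formal power series in $z$, $$\exp\Bigl(-\sum_{k=0}^\infty s_kz^{k+1}\Bigr)=1-\sum_{k=0}^\infty c_kz^{k+1},$$ where $s_k=\int_{\mathbb R} x^k\,\rho(dx)$ and $c_k=\int_{\mathbb R} x^k\,Q(\rho)(dx)$ are the moments of $\rho$ and $Q(\rho)$. The operation $Q$ intertwines the free convolution and its quantized version: for all $\rho_1,\rho_2\in\mathcal{B}$ the measures $\rho_1\otimes\rho_2\in\mathcal B$ and $Q(\rho_1)\boxplus Q(\rho_2)$ exist and are unique, and $$Q(\rho_1)\boxplus Q(\rho_2)=Q(\rho_1\otimes\rho_2).$$ -/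

import Mathlib

open MeasureTheory

open scoped PowerSeries LaurentSeries

noncomputable section

/-- The measure is concentrated on a compact set. -/
def HasCompactSupp (m : Measure ℝ) : Prop :=
  ∃ K : Set ℝ, IsCompact K ∧ m Kᶜ = 0

/-- The measure is absolutely continuous with respect to the Lebesgue measure, with a density
that is at most `1` almost everywhere. -/
def HasDensityAtMostOne (m : Measure ℝ) : Prop :=
  m ≪ (volume : Measure ℝ) ∧ ∀ᵐ x ∂(volume : Measure ℝ), m.rnDeriv volume x ≤ 1

/-- Compactly supported probability measures on `ℝ`. -/
def CompactProb : Type :=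
  {m : Measure ℝ // IsProbabilityMeasure m ∧ HasCompactSupp m}

/-- Compactly supported probability measures on `ℝ` which are absolutely continuous with respect
to the Lebesgue measure, with density at most `1`. -/
def BoundedDensityProb : Type :=
  {m : Measure ℝ // IsProbabilityMeasure m ∧ HasCompactSupp m ∧ HasDensityAtMostOne m}

/-- Forget the condition on the density. -/
def BoundedDensityProb.toCompactProb (ρ : BoundedDensityProb) : CompactProb :=
  ⟨ρ.1, ρ.2.1, ρ.2.2.1⟩

/-- The `k`-th moment `M_k(m) = ∫ x ^ k m(dx)`. -/
def moment (m : CompactProb) (k : ℕ) : ℝ :=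
  ∫ x : ℝ, x ^ k ∂m.1

/-- The moment series `S_m(z) = ∑_{k ≥ 0} M_k(m) z ^ (k + 1)`, as a formal power series. -/
def momentSeries (m : CompactProb) : ℝ⟦X⟧ :=
  PowerSeries.X * PowerSeries.mk (moment m)

theorem constantCoeff_momentSeries (m : CompactProb) :
    (momentSeries m).constantCoeff = 0 := by
  simp [momentSeries]

theorem coeff_one_momentSeries (m : CompactProb) :
    (momentSeries m).coeff 1 = 1 := by
  have := m.2.1
  have h : (momentSeries m).coeff (0 + 1) = moment m 0 := by
    rw [momentSeries, PowerSeries.coeff_succ_X_mul, PowerSeries.coeff_mk]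
  rw [zero_add] at h
  rw [h]
  simp [moment]

/-- The compositional inverse `S_m^{(-1)}(z)` of the moment series. -/
def inverseMomentSeries (m : CompactProb) : ℝ⟦X⟧ :=
  (momentSeries m).substInvOfIsUnit (by rw [coeff_one_momentSeries]; exact isUnit_one)

theorem momentSeries_subst_inverse (m : CompactProb) :
    (momentSeries m).subst (inverseMomentSeries m) = PowerSeries.X :=
  PowerSeries.subst_substInvOfIsUnit_right _ (constantCoeff_momentSeries m) _

theorem inverse_subst_momentSeries (m : CompactProb) :
    (inverseMomentSeries m).subst (momentSeries m) = PowerSeries.X :=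
  PowerSeries.subst_substInvOfIsUnit_left _ (constantCoeff_momentSeries m) _

/-- The formal power series `e ^ (-z)`. -/
def expNeg : ℝ⟦X⟧ :=
  (PowerSeries.exp ℝ).subst (-PowerSeries.X : ℝ⟦X⟧)

/-- The Voiculescu `R`-transform `R_m(z) = 1 / S_m^{(-1)}(z) - 1 / z`, computed in the field of
formal Laurent series. -/
def rTransform (m : CompactProb) : ℝ⸨X⸩ :=
  ((inverseMomentSeries m : ℝ⟦X⟧) : ℝ⸨X⸩)⁻¹ - ((PowerSeries.X : ℝ⟦X⟧) : ℝ⸨X⸩)⁻¹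

/-- The quantized `R`-transform `R_m^quant(z) = 1 / S_m^{(-1)}(z) - 1 / (1 - e ^ (-z))`, computed
in the field of formal Laurent series. -/
def quantizedRTransform (m : CompactProb) : ℝ⸨X⸩ :=
  ((inverseMomentSeries m : ℝ⟦X⟧) : ℝ⸨X⸩)⁻¹ - ((1 - expNeg : ℝ⟦X⟧) : ℝ⸨X⸩)⁻¹

/-- `τ` is the free convolution of `μ` and `ν`. -/
def IsFreeConvolution (μ ν τ : CompactProb) : Prop :=
  rTransform μ + rTransform ν = rTransform τ

/-- `σ` is the quantized free convolution of `ρ₁` and `ρ₂`. The operation is restricted to the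
measures with density at most `1`, and so `σ` is required to belong to this class. -/
def IsQuantizedFreeConvolution (ρ₁ ρ₂ σ : BoundedDensityProb) : Prop :=
  quantizedRTransform ρ₁.toCompactProb + quantizedRTransform ρ₂.toCompactProb =
    quantizedRTransform σ.toCompactProb

theorem compactProb_nonempty : Nonempty CompactProb :=
  ⟨⟨Measure.dirac 0, inferInstance, {0}, isCompact_singleton, by simp⟩⟩

theorem boundedDensityProb_nonempty : Nonempty BoundedDensityProb := by
  refine ⟨⟨(volume : Measure ℝ).restrict (Set.Icc 0 1), ⟨by simp⟩, ⟨Set.Icc 0 1, isCompact_Icc, ?_⟩,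
    Measure.restrict_le_self.absolutelyContinuous, ?_⟩⟩
  · rw [Measure.restrict_apply measurableSet_Icc.compl]
    simp
  · filter_upwards [Measure.rnDeriv_restrict_self (volume : Measure ℝ)
      (measurableSet_Icc (a := (0 : ℝ)) (b := 1))] with x hx
    rw [hx]
    exact Set.indicator_le_self' (fun _ _ => zero_le) x

/-- The free convolution `μ ⊞ ν`: the compactly supported probability measure whose `R`-transform
is the sum of those of `μ` and `ν`. -/
def freeConvolution (μ ν : CompactProb) : CompactProb :=
  @Classical.epsilon _ compactProb_nonempty (IsFreeConvolution μ ν)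

/-- The quantized free convolution `ρ₁ ⊗ ρ₂`: the compactly supported probability measure with
density at most `1` whose quantized `R`-transform is the sum of those of `ρ₁` and `ρ₂`. -/
def quantizedFreeConvolution (ρ₁ ρ₂ : BoundedDensityProb) : BoundedDensityProb :=
  @Classical.epsilon _ boundedDensityProb_nonempty (IsQuantizedFreeConvolution ρ₁ ρ₂)

/-- The identity `exp (-∑ s_k z ^ (k + 1)) = 1 - ∑ c_k z ^ (k + 1)` of formal power series, where
`s_k` and `c_k` are the moments of `ρ` and `ν`. -/
def ExpMomentIdentity (ρ ν : CompactProb) : Prop :=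
  (PowerSeries.exp ℝ).subst (-momentSeries ρ) = 1 - momentSeries ν

end

/-! Put f(z) = 1 - e^(-z). The exponential identity says that the moment series of Q(ρ) is f
composed with that of ρ. Passing to compositional inverses, the inverse series of ρ is that of Q(ρ)
with f substituted (`ExpMomentIdentity.inverseMomentSeries_eq`), so the quantized R-transform of ρ
is the R-transform of Q(ρ) evaluated at f(z). Since f is invertible under composition, additivity of
one transform is equivalent to additivity of the other
(`isQuantizedFreeConvolution_iff_isFreeConvolution`). Moments determine compactly supported
measures, which gives uniqueness. What remains is existence, of three kinds.

Q exists and is onto (`exists_expMomentIdentity`, `exists_boundedDensityProb_expMomentIdentity`).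
For Lebesgue measure on disjoint intervals [y_i, x_i) of total length 1, exponentiating the moment
series gives ∏ (1 - x_i z) / (1 - y_i z). Its partial fraction expansion is 1 - ∑ w_i z / (1 - y_i
z), which is 1 minus the moment series of the measure with masses w_i at y_i. Interlacing of the x_i
and y_i makes the residues nonnegative; conversely, positive residues force interlacing zeros.
General measures are limits of these: a grid cell holds mass at most its length when the density is
at most 1, and this density bound survives weak limits. Surjectivity of Q is what places the
quantized convolution inside the class of bounded densities.

Free convolutions exist (`exists_isFreeConvolution`). A uniform measure on 2^k points, repetitions
allowed, is the law of an element of the real group algebra of {1, -1}^k. Two such elements, placed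
in the two factors of a free product of groups, are free for the canonical trace, and their sum is
bounded and self-adjoint, so its moments come from a measure (`exists_compactProb_groupTrace`). A
resolvent identity shows that its R-transform is the sum (`AlternatingSpaces.subst_add_eq_one`). The
strong law of large numbers and compactness yield the general case. -/

open Filter Topology

/-! ### Formal power series: substitution, coefficientwise limits, sums of reciprocals. -/

section FormalSeries

/-- Since X^d divides g^d, only d ≤ n contributes. Each coefficient of a composition is thus a
polynomial in finitely many coefficients, the source of all continuity statements below. -/
theorem coeff_subst_eq_sum {f g : ℝ⟦X⟧} (hg : g.constantCoeff = 0) (n : ℕ) :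
    PowerSeries.coeff n (f.subst g) = ∑ d ∈ Finset.range (n + 1), f.coeff d * (g ^ d).coeff n := by
  rw [PowerSeries.coeff_subst' (PowerSeries.HasSubst.of_constantCoeff_zero' hg)]
  rw [finsum_eq_sum_of_support_subset (s := Finset.range (n + 1))]
  · simp
  · intro d hd
    by_contra h
    apply hd
    simp only [Finset.coe_range, Set.mem_Iio, not_lt] at h
    have : PowerSeries.X ^ d ∣ g ^ d := pow_dvd_pow_of_dvd (PowerSeries.X_dvd_iff.2 hg) d
    simp [PowerSeries.X_pow_dvd_iff.1 this n (by omega)]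

theorem coeff_pow_self {S : ℝ⟦X⟧} (h0 : S.constantCoeff = 0) (h1 : S.coeff 1 = 1) (n : ℕ) :
    (S ^ n).coeff n = 1 := by
  obtain ⟨T, rfl⟩ := PowerSeries.X_dvd_iff.2 h0
  have hT : T.constantCoeff = 1 := by
    have := PowerSeries.coeff_succ_X_mul 0 T
    simpa [h1] using this.symm
  have := PowerSeries.coeff_X_pow_mul (T ^ n) n 0
  rw [mul_pow, ← zero_add n]
  simpa [hT] using this

open scoped PowerSeries.WithPiTopology in
theorem tendsto_coeff_pow {ι : Type*} {l : Filter ι} {f : ι → ℝ⟦X⟧} {g : ℝ⟦X⟧}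
    (h : ∀ n, Tendsto (fun j => (f j).coeff n) l (𝓝 (g.coeff n))) (d n : ℕ) :
    Tendsto (fun j => (f j ^ d).coeff n) l (𝓝 ((g ^ d).coeff n)) := by
  have hf : Tendsto f l (𝓝 g) := (PowerSeries.WithPiTopology.tendsto_iff_coeff_tendsto ..).2 h
  exact (PowerSeries.WithPiTopology.tendsto_iff_coeff_tendsto ..).1 (hf.pow d) n

open scoped PowerSeries.WithPiTopology in
theorem tendsto_coeff_mul {ι : Type*} {l : Filter ι} {f f' : ι → ℝ⟦X⟧} {g g' : ℝ⟦X⟧}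
    (h : ∀ n, Tendsto (fun j => (f j).coeff n) l (𝓝 (g.coeff n)))
    (h' : ∀ n, Tendsto (fun j => (f' j).coeff n) l (𝓝 (g'.coeff n))) (n : ℕ) :
    Tendsto (fun j => (f j * f' j).coeff n) l (𝓝 ((g * g').coeff n)) := by
  have hf : Tendsto f l (𝓝 g) := (PowerSeries.WithPiTopology.tendsto_iff_coeff_tendsto ..).2 h
  have hf' : Tendsto f' l (𝓝 g') := (PowerSeries.WithPiTopology.tendsto_iff_coeff_tendsto ..).2 h'
  exact (PowerSeries.WithPiTopology.tendsto_iff_coeff_tendsto ..).1 (hf.mul hf') n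

theorem tendsto_coeff_add {ι : Type*} {l : Filter ι} {f f' : ι → ℝ⟦X⟧} {g g' : ℝ⟦X⟧}
    (h : ∀ n, Tendsto (fun j => (f j).coeff n) l (𝓝 (g.coeff n)))
    (h' : ∀ n, Tendsto (fun j => (f' j).coeff n) l (𝓝 (g'.coeff n))) (n : ℕ) :
    Tendsto (fun j => (f j + f' j).coeff n) l (𝓝 ((g + g').coeff n)) := by
  simpa only [map_add] using (h n).add (h' n)

theorem tendsto_coeff_subst {ι : Type*} {l : Filter ι} {f : ι → ℝ⟦X⟧} {g F : ℝ⟦X⟧}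
    (hf : ∀ j, (f j).constantCoeff = 0) (hg : g.constantCoeff = 0)
    (h : ∀ n, Tendsto (fun j => (f j).coeff n) l (𝓝 (g.coeff n))) (n : ℕ) :
    Tendsto (fun j => PowerSeries.coeff n (F.subst (f j))) l
      (𝓝 (PowerSeries.coeff n (F.subst g))) := by
  rw [coeff_subst_eq_sum hg]
  simp_rw [coeff_subst_eq_sum (hf _)]
  exact tendsto_finsetSum _ fun d _ => (tendsto_coeff_pow h d n).const_mul _

/-- Compositional inverses depend continuously on the coefficients. -/
theorem tendsto_coeff_of_subst_eq_X {ι : Type*} {l : Filter ι} {S u : ι → ℝ⟦X⟧} {S' u' : ℝ⟦X⟧}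
    (hS0 : ∀ j, (S j).constantCoeff = 0) (hS1 : ∀ j, (S j).coeff 1 = 1)
    (hS0' : S'.constantCoeff = 0) (hS1' : S'.coeff 1 = 1)
    (hu : ∀ j, (u j).subst (S j) = PowerSeries.X) (hu' : u'.subst S' = PowerSeries.X)
    (h : ∀ n, Tendsto (fun j => (S j).coeff n) l (𝓝 (S'.coeff n))) (n : ℕ) :
    Tendsto (fun j => (u j).coeff n) l (𝓝 (u'.coeff n)) := by
  -- The coefficient of X^n in S^n is 1, so u ∘ S = X can be solved recursively for the n-th
  -- coefficient of u.
  have key : ∀ {S u : ℝ⟦X⟧}, S.constantCoeff = 0 → S.coeff 1 = 1 → u.subst S = PowerSeries.X →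
      ∀ n, u.coeff n = (PowerSeries.X : ℝ⟦X⟧).coeff n
        - ∑ d ∈ Finset.range n, u.coeff d * (S ^ d).coeff n := by
    intro S u h0 h1 h n
    rw [← h, coeff_subst_eq_sum h0, Finset.sum_range_succ, coeff_pow_self h0 h1]
    ring
  induction n using Nat.strong_induction_on with
  | _ n ih =>
    rw [key hS0' hS1' hu' n]
    have : (fun j => (u j).coeff n) = fun j => (PowerSeries.X : ℝ⟦X⟧).coeff n
        - ∑ d ∈ Finset.range n, (u j).coeff d * (S j ^ d).coeff n :=
      funext fun j => key (hS0 j) (hS1 j) (hu j) n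
    rw [this]
    exact tendsto_const_nhds.sub (tendsto_finsetSum _ fun d hd =>
      (ih d (Finset.mem_range.1 hd)).mul (tendsto_coeff_pow h d n))

/-- The equation `1 / a + 1 / b = 1 / c + 1 / e` with the denominators cleared. -/
def SumInvEq (a b c e : ℝ⟦X⟧) : Prop :=
  (a + b) * c * e = a * b * (c + e)

/-- Clearing denominators moves additivity of both transforms from Laurent series to power series,
where substitution and coefficientwise limits are available. The two transforms differ only in `e`:
X or 1 - e^(-X). -/
theorem sumInvEq_iff {a b c e : ℝ⟦X⟧} (ha : a ≠ 0) (hb : b ≠ 0) (hc : c ≠ 0) (he : e ≠ 0) :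
    (((a : ℝ⸨X⸩)⁻¹ - (e : ℝ⸨X⸩)⁻¹) + ((b : ℝ⸨X⸩)⁻¹ - (e : ℝ⸨X⸩)⁻¹)
      = (c : ℝ⸨X⸩)⁻¹ - (e : ℝ⸨X⸩)⁻¹) ↔ SumInvEq a b c e := by
  have inj : Function.Injective (fun f : ℝ⟦X⟧ => (f : ℝ⸨X⸩)) := HahnSeries.ofPowerSeries_injective
  have nz : ∀ {f : ℝ⟦X⟧}, f ≠ 0 → (f : ℝ⸨X⸩) ≠ 0 := fun {f} hf h =>
    hf (inj (by simpa using h))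
  have ha' := nz ha
  have hb' := nz hb
  have hc' := nz hc
  have he' := nz he
  rw [SumInvEq, ← inj.eq_iff]
  simp only [map_mul, map_add]
  constructor
  · intro h
    field_simp at h
    linear_combination h
  · intro h
    field_simp
    linear_combination h

theorem SumInvEq.subst {a b c e f : ℝ⟦X⟧} (hf : f.constantCoeff = 0) (h : SumInvEq a b c e) :
    SumInvEq (a.subst f) (b.subst f) (c.subst f) (e.subst f) := by
  have hs : PowerSeries.HasSubst f := .of_constantCoeff_zero' hf
  have := congrArg (PowerSeries.subst f) h
  simpa only [SumInvEq, PowerSeries.subst_mul hs, PowerSeries.subst_add hs] using this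

theorem constantCoeff_expNeg : expNeg.constantCoeff = 1 := by
  have h := coeff_subst_eq_sum (f := PowerSeries.exp ℝ) (g := -PowerSeries.X) (by simp) 0
  simpa [expNeg] using h

theorem coeff_one_expNeg : expNeg.coeff 1 = -1 := by
  have h := coeff_subst_eq_sum (f := PowerSeries.exp ℝ) (g := -PowerSeries.X) (by simp) 1
  simpa [expNeg, Finset.sum_range_succ, PowerSeries.coeff_exp] using h

theorem constantCoeff_one_sub_expNeg : (1 - expNeg).constantCoeff = 0 := by
  simp [constantCoeff_expNeg]

theorem coeff_one_one_sub_expNeg : (1 - expNeg).coeff 1 = 1 := by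
  simp [coeff_one_expNeg, PowerSeries.coeff_one]

/-- The series 1 - e^(-X) starts with X, so it has a compositional inverse and the substitution can
be undone. -/
theorem sumInvEq_subst_iff {a b c : ℝ⟦X⟧} :
    SumInvEq (a.subst (1 - expNeg)) (b.subst (1 - expNeg)) (c.subst (1 - expNeg)) (1 - expNeg) ↔
      SumInvEq a b c PowerSeries.X := by
  have h0 := constantCoeff_one_sub_expNeg
  have hs : PowerSeries.HasSubst (1 - expNeg : ℝ⟦X⟧) := .of_constantCoeff_zero' h0
  have hu : IsUnit ((1 - expNeg).coeff 1) := by rw [coeff_one_one_sub_expNeg]; exact isUnit_one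
  constructor
  · intro h
    have h2 := h.subst (PowerSeries.constantCoeff_substInvOfIsUnit _ hu)
    have hs' := PowerSeries.HasSubst.substInvOfIsUnit _ hu
    simpa only [PowerSeries.subst_comp_subst_apply hs hs',
      PowerSeries.subst_substInvOfIsUnit_right _ h0 hu, ← PowerSeries.map_algebraMap_eq_subst_X,
      Algebra.algebraMap_self, PowerSeries.map_id, RingHom.id_apply, id] using h2
  · intro h
    simpa only [PowerSeries.subst_X hs] using h.subst h0

end FormalSeries

/-! ### Inverse moment series and the two convolution relations. -/

section Transforms

theorem constantCoeff_inverseMomentSeries (m : CompactProb) :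
    (inverseMomentSeries m).constantCoeff = 0 :=
  PowerSeries.constantCoeff_substInvOfIsUnit _ _

theorem ne_zero_of_subst_eq_X {u S : ℝ⟦X⟧} (h : u.subst S = PowerSeries.X)
    (hS : S.constantCoeff = 0) : u ≠ 0 := by
  rintro rfl
  have : (0 : ℝ⟦X⟧).subst S = 0 := by
    rw [← PowerSeries.coe_substAlgHom (.of_constantCoeff_zero' hS), map_zero]
  exact PowerSeries.X_ne_zero (h.symm.trans this)

theorem inverseMomentSeries_ne_zero (m : CompactProb) : inverseMomentSeries m ≠ 0 :=
  ne_zero_of_subst_eq_X (inverse_subst_momentSeries m) (constantCoeff_momentSeries m)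

/-- A left compositional inverse of the moment series is the inverse moment series. -/
theorem eq_inverseMomentSeries {m : CompactProb} {u : ℝ⟦X⟧}
    (h : u.subst (momentSeries m) = PowerSeries.X) : u = inverseMomentSeries m := by
  have h1 := congrArg (PowerSeries.subst (inverseMomentSeries m)) h
  have hS : PowerSeries.HasSubst (momentSeries m) :=
    .of_constantCoeff_zero' (constantCoeff_momentSeries m)
  have hI : PowerSeries.HasSubst (inverseMomentSeries m) :=
    .of_constantCoeff_zero' (constantCoeff_inverseMomentSeries m)
  rwa [PowerSeries.subst_comp_subst_apply hS hI, momentSeries_subst_inverse,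
    ← PowerSeries.map_algebraMap_eq_subst_X, PowerSeries.subst_X hI, Algebra.algebraMap_self,
    PowerSeries.map_id] at h1

/-- A right compositional inverse of the moment series is the inverse moment series. -/
theorem eq_inverseMomentSeries' {m : CompactProb} {u : ℝ⟦X⟧} (hu : u.constantCoeff = 0)
    (h : (momentSeries m).subst u = PowerSeries.X) : u = inverseMomentSeries m := by
  have h1 := congrArg (fun f => (inverseMomentSeries m).subst f) h
  have hS : PowerSeries.HasSubst (momentSeries m) :=
    .of_constantCoeff_zero' (constantCoeff_momentSeries m)
  have hI : PowerSeries.HasSubst u := .of_constantCoeff_zero' hu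
  rwa [← PowerSeries.subst_comp_subst_apply hS hI, inverse_subst_momentSeries,
    ← PowerSeries.map_algebraMap_eq_subst_X, PowerSeries.subst_X hI, Algebra.algebraMap_self,
    PowerSeries.map_id] at h1

theorem momentSeries_eq_of_inverse_eq {m m' : CompactProb}
    (h : inverseMomentSeries m = inverseMomentSeries m') : momentSeries m = momentSeries m' := by
  have hS : PowerSeries.HasSubst (momentSeries m) :=
    .of_constantCoeff_zero' (constantCoeff_momentSeries m)
  have hI : PowerSeries.HasSubst (inverseMomentSeries m) :=
    .of_constantCoeff_zero' (constantCoeff_inverseMomentSeries m)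
  have h1 := congrArg (PowerSeries.subst (momentSeries m))
    (h ▸ momentSeries_subst_inverse m' :
      (momentSeries m').subst (inverseMomentSeries m) = PowerSeries.X)
  rw [PowerSeries.subst_comp_subst_apply hI hS, inverse_subst_momentSeries,
    ← PowerSeries.map_algebraMap_eq_subst_X, PowerSeries.subst_X hS, Algebra.algebraMap_self,
    PowerSeries.map_id] at h1
  exact h1.symm

theorem moment_eq_coeff (m : CompactProb) (k : ℕ) :
    moment m k = (momentSeries m).coeff (k + 1) := by
  rw [momentSeries, PowerSeries.coeff_succ_X_mul, PowerSeries.coeff_mk]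

theorem isFreeConvolution_iff {μ ν τ : CompactProb} :
    IsFreeConvolution μ ν τ ↔ SumInvEq (inverseMomentSeries μ) (inverseMomentSeries ν)
      (inverseMomentSeries τ) PowerSeries.X :=
  sumInvEq_iff (inverseMomentSeries_ne_zero _) (inverseMomentSeries_ne_zero _)
    (inverseMomentSeries_ne_zero _) PowerSeries.X_ne_zero

theorem one_sub_expNeg_ne_zero : (1 - expNeg : ℝ⟦X⟧) ≠ 0 := by
  intro h
  have := coeff_one_one_sub_expNeg
  simp [h] at this

theorem isQuantizedFreeConvolution_iff {ρ₁ ρ₂ σ : BoundedDensityProb} :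
    IsQuantizedFreeConvolution ρ₁ ρ₂ σ ↔ SumInvEq (inverseMomentSeries ρ₁.toCompactProb)
      (inverseMomentSeries ρ₂.toCompactProb) (inverseMomentSeries σ.toCompactProb) (1 - expNeg) :=
  sumInvEq_iff (inverseMomentSeries_ne_zero _) (inverseMomentSeries_ne_zero _)
    (inverseMomentSeries_ne_zero _) one_sub_expNeg_ne_zero

/-- The identity reads S_ν = (1 - e^(-z)) ∘ S_ρ; inverting reverses the order of composition. -/
theorem ExpMomentIdentity.inverseMomentSeries_eq {ρ ν : CompactProb} (h : ExpMomentIdentity ρ ν) :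
    inverseMomentSeries ρ = (inverseMomentSeries ν).subst (1 - expNeg) := by
  have hS : PowerSeries.HasSubst (momentSeries ρ) :=
    .of_constantCoeff_zero' (constantCoeff_momentSeries ρ)
  have he : PowerSeries.HasSubst (1 - expNeg : ℝ⟦X⟧) :=
    .of_constantCoeff_zero' constantCoeff_one_sub_expNeg
  have hX : PowerSeries.HasSubst (-PowerSeries.X : ℝ⟦X⟧) := .of_constantCoeff_zero' (by simp)
  symm
  apply eq_inverseMomentSeries
  rw [PowerSeries.subst_comp_subst_apply he hS]
  have : (1 - expNeg).subst (momentSeries ρ) = momentSeries ν := by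
    rw [PowerSeries.subst_sub hS, expNeg, PowerSeries.subst_comp_subst_apply hX hS,
      ← PowerSeries.coe_substAlgHom hS, map_neg, map_one, PowerSeries.coe_substAlgHom hS,
      PowerSeries.subst_X hS]
    rw [ExpMomentIdentity] at h
    rw [h]
    ring
  rw [this, inverse_subst_momentSeries]

/-- This is the intertwining property at the level of relations: the quantized equation is the free
one with 1 - e^(-z) substituted for z. -/
theorem isQuantizedFreeConvolution_iff_isFreeConvolution {ρ₁ ρ₂ σ : BoundedDensityProb}
    {ν₁ ν₂ τ : CompactProb} (h₁ : ExpMomentIdentity ρ₁.toCompactProb ν₁)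
    (h₂ : ExpMomentIdentity ρ₂.toCompactProb ν₂) (h : ExpMomentIdentity σ.toCompactProb τ) :
    IsQuantizedFreeConvolution ρ₁ ρ₂ σ ↔ IsFreeConvolution ν₁ ν₂ τ := by
  rw [isQuantizedFreeConvolution_iff, isFreeConvolution_iff, h₁.inverseMomentSeries_eq,
    h₂.inverseMomentSeries_eq, h.inverseMomentSeries_eq, sumInvEq_subst_iff]

theorem inverseMomentSeries_eq_of_sub_inv_eq {m m' : CompactProb} {c : ℝ⸨X⸩}
    (h : ((inverseMomentSeries m : ℝ⟦X⟧) : ℝ⸨X⸩)⁻¹ - c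
      = ((inverseMomentSeries m' : ℝ⟦X⟧) : ℝ⸨X⸩)⁻¹ - c) :
    inverseMomentSeries m = inverseMomentSeries m' :=
  HahnSeries.ofPowerSeries_injective (inv_injective (sub_left_injective h))

theorem tendsto_coeff_momentSeries {ι : Type*} {l : Filter ι} {m : ι → CompactProb}
    {m' : CompactProb} (h : ∀ k, Tendsto (fun j => moment (m j) k) l (𝓝 (moment m' k))) (n : ℕ) :
    Tendsto (fun j => (momentSeries (m j)).coeff n) l (𝓝 ((momentSeries m').coeff n)) := by
  cases n with
  | zero =>
    simp only [PowerSeries.coeff_zero_eq_constantCoeff, constantCoeff_momentSeries]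
    exact tendsto_const_nhds
  | succ k => simpa only [← moment_eq_coeff] using h k

theorem tendsto_coeff_inverseMomentSeries {ι : Type*} {l : Filter ι} {m : ι → CompactProb}
    {m' : CompactProb} (h : ∀ k, Tendsto (fun j => moment (m j) k) l (𝓝 (moment m' k))) (n : ℕ) :
    Tendsto (fun j => (inverseMomentSeries (m j)).coeff n) l
      (𝓝 ((inverseMomentSeries m').coeff n)) :=
  tendsto_coeff_of_subst_eq_X (fun _ => constantCoeff_momentSeries _)
    (fun _ => coeff_one_momentSeries _) (constantCoeff_momentSeries _) (coeff_one_momentSeries _)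
    (fun _ => inverse_subst_momentSeries _) (inverse_subst_momentSeries _)
    (tendsto_coeff_momentSeries h) n

/-- The relation of free convolution passes to limits of moments. -/
theorem IsFreeConvolution.of_tendsto {μ ν τ : ℕ → CompactProb} {μ' ν' τ' : CompactProb}
    (h : ∀ j, IsFreeConvolution (μ j) (ν j) (τ j))
    (hμ : ∀ k, Tendsto (fun j => moment (μ j) k) atTop (𝓝 (moment μ' k)))
    (hν : ∀ k, Tendsto (fun j => moment (ν j) k) atTop (𝓝 (moment ν' k)))
    (hτ : ∀ k, Tendsto (fun j => moment (τ j) k) atTop (𝓝 (moment τ' k))) :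
    IsFreeConvolution μ' ν' τ' := by
  simp only [isFreeConvolution_iff, SumInvEq] at h ⊢
  have hX : ∀ n, Tendsto (fun _ : ℕ => (PowerSeries.X : ℝ⟦X⟧).coeff n) atTop
      (𝓝 ((PowerSeries.X : ℝ⟦X⟧).coeff n)) := fun _ => tendsto_const_nhds
  have hμ := tendsto_coeff_inverseMomentSeries hμ
  have hν := tendsto_coeff_inverseMomentSeries hν
  have hτ := tendsto_coeff_inverseMomentSeries hτ
  ext n
  have h1 := tendsto_coeff_mul (tendsto_coeff_mul (tendsto_coeff_add hμ hν) hτ) hX n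
  have h2 := tendsto_coeff_mul (tendsto_coeff_mul hμ hν) (tendsto_coeff_add hτ hX) n
  refine tendsto_nhds_unique h1 ?_
  simpa only [h] using h2

/-- The exponential moment identity passes to limits of moments. -/
theorem ExpMomentIdentity.of_tendsto {ρ ν : ℕ → CompactProb} {ρ' ν' : CompactProb}
    (h : ∀ j, ExpMomentIdentity (ρ j) (ν j))
    (hρ : ∀ k, Tendsto (fun j => moment (ρ j) k) atTop (𝓝 (moment ρ' k)))
    (hν : ∀ k, Tendsto (fun j => moment (ν j) k) atTop (𝓝 (moment ν' k))) :
    ExpMomentIdentity ρ' ν' := by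
  simp only [ExpMomentIdentity] at h ⊢
  ext n
  have h1 := tendsto_coeff_subst (F := PowerSeries.exp ℝ) (f := fun j => -momentSeries (ρ j))
    (g := -momentSeries ρ') (l := atTop) (by simp [constantCoeff_momentSeries])
    (by simp [constantCoeff_momentSeries])
    (fun n => by simpa only [map_neg] using (tendsto_coeff_momentSeries hρ n).neg) n
  have h2 := (tendsto_const_nhds (x := (1 : ℝ⟦X⟧).coeff n)).sub (tendsto_coeff_momentSeries hν n)
  refine tendsto_nhds_unique h1 ?_
  simpa only [h, map_sub] using h2

end Transforms

/-! ### Compactly supported measures: moments, weak limits, discretization. -/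

section Measures

instance (m : CompactProb) : IsProbabilityMeasure m.1 := m.2.1

theorem hasCompactSupp_iff {m : Measure ℝ} :
    HasCompactSupp m ↔ ∃ C : ℝ, ∀ᵐ x ∂m, |x| ≤ C := by
  constructor
  · rintro ⟨K, hK, h⟩
    obtain ⟨C, hC⟩ := hK.isBounded.exists_norm_le
    refine ⟨C, measure_mono_null (fun x hx hxK => hx (hC x hxK)) h⟩
  · rintro ⟨C, h⟩
    refine ⟨Set.Icc (-C) C, isCompact_Icc, measure_mono_null
      (fun x hx hx' => hx (abs_le.1 hx')) (ae_iff.1 h)⟩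

theorem integrable_of_continuous_of_ae_abs_le {m : Measure ℝ} [IsFiniteMeasure m] {C : ℝ}
    (h : ∀ᵐ x ∂m, |x| ≤ C) {f : ℝ → ℝ} (hf : Continuous f) : Integrable f m := by
  obtain ⟨B, hB⟩ := (isCompact_Icc (a := -C) (b := C)).exists_bound_of_continuousOn hf.continuousOn
  refine Integrable.of_bound hf.aestronglyMeasurable B ?_
  filter_upwards [h] with x hx
  exact hB x (abs_le.1 hx)

theorem integrable_pow_of_ae_abs_le {m : Measure ℝ} [IsFiniteMeasure m] {C : ℝ}
    (h : ∀ᵐ x ∂m, |x| ≤ C) (k : ℕ) : Integrable (fun x => x ^ k) m :=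
  integrable_of_continuous_of_ae_abs_le h (continuous_pow k)

theorem integral_polynomial_eq {m m' : CompactProb} (h : ∀ k, moment m k = moment m' k)
    (p : Polynomial ℝ) : ∫ x, p.eval x ∂m.1 = ∫ x, p.eval x ∂m'.1 := by
  obtain ⟨C, hC⟩ := hasCompactSupp_iff.1 m.2.2
  obtain ⟨C', hC'⟩ := hasCompactSupp_iff.1 m'.2.2
  simp only [Polynomial.eval_eq_sum_range]
  rw [integral_finsetSum _ fun k _ => (integrable_pow_of_ae_abs_le hC k).const_mul _,
    integral_finsetSum _ fun k _ => (integrable_pow_of_ae_abs_le hC' k).const_mul _]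
  refine Finset.sum_congr rfl fun k _ => ?_
  rw [integral_const_mul, integral_const_mul]
  exact congrArg _ (h k)

/-- A compactly supported probability measure is determined by its moments. -/
theorem CompactProb.ext_moment {m m' : CompactProb} (h : ∀ k, moment m k = moment m' k) :
    m = m' := by
  obtain ⟨C, hC⟩ := hasCompactSupp_iff.1 m.2.2
  obtain ⟨C', hC'⟩ := hasCompactSupp_iff.1 m'.2.2
  apply Subtype.ext
  apply ext_of_forall_integral_eq_of_IsFiniteMeasure
  intro f
  rw [← sub_eq_zero, ← abs_eq_zero]
  refine le_antisymm (le_of_forall_pos_le_add fun ε hε => ?_) (abs_nonneg _)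
  -- Weierstrass approximation on one interval that carries both measures.
  obtain ⟨p, hp⟩ := exists_polynomial_near_of_continuousOn (-(max C C')) (max C C') f
    f.continuous.continuousOn (ε / 2) (half_pos hε)
  have key : ∀ (m : CompactProb) (D : ℝ), D ≤ max C C' → (∀ᵐ x ∂m.1, |x| ≤ D) →
      |∫ x, f x ∂m.1 - ∫ x, p.eval x ∂m.1| ≤ ε / 2 := by
    intro m D hD hm
    rw [← integral_sub (integrable_of_continuous_of_ae_abs_le hm f.continuous)
      (integrable_of_continuous_of_ae_abs_le hm p.continuous), ← Real.norm_eq_abs]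
    have := norm_integral_le_of_norm_le_const (μ := m.1) (f := fun x => f x - p.eval x)
      (C := ε / 2) (by
        filter_upwards [hm] with x hx
        rw [Real.norm_eq_abs, abs_sub_comm]
        exact (hp x (abs_le.1 (hx.trans hD))).le)
    simpa using this
  have h1 := abs_le.1 (key m C (le_max_left _ _) hC)
  have h2 := abs_le.1 (key m' C' (le_max_right _ _) hC')
  have h3 := integral_polynomial_eq h p
  rw [abs_le]
  constructor <;> linarith [h1.1, h1.2, h2.1, h2.2]

theorem BoundedDensityProb.toCompactProb_injective :
    Function.Injective BoundedDensityProb.toCompactProb := fun _ _ h =>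
  Subtype.ext (congrArg (fun m : CompactProb => m.1) h)

theorem CompactProb.ext_momentSeries {m m' : CompactProb} (h : momentSeries m = momentSeries m') :
    m = m' :=
  CompactProb.ext_moment fun k => by rw [moment_eq_coeff, moment_eq_coeff, h]

theorem IsFreeConvolution.unique {μ ν τ τ' : CompactProb} (h : IsFreeConvolution μ ν τ)
    (h' : IsFreeConvolution μ ν τ') : τ = τ' :=
  CompactProb.ext_momentSeries <| momentSeries_eq_of_inverse_eq <|
    inverseMomentSeries_eq_of_sub_inv_eq (h.symm.trans h')

theorem IsQuantizedFreeConvolution.unique {ρ₁ ρ₂ σ σ' : BoundedDensityProb}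
    (h : IsQuantizedFreeConvolution ρ₁ ρ₂ σ) (h' : IsQuantizedFreeConvolution ρ₁ ρ₂ σ') :
    σ = σ' := by
  have : σ.toCompactProb = σ'.toCompactProb :=
    CompactProb.ext_momentSeries <| momentSeries_eq_of_inverse_eq <|
      inverseMomentSeries_eq_of_sub_inv_eq (h.symm.trans h')
  exact BoundedDensityProb.toCompactProb_injective this

/-- Domination by Lebesgue measure is the form of the condition that passes to weak limits and is
evident for restrictions. -/
theorem hasDensityAtMostOne_iff {m : Measure ℝ} [IsFiniteMeasure m] :
    HasDensityAtMostOne m ↔ m ≤ volume := by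
  constructor
  · rintro ⟨h1, h2⟩
    rw [← Measure.withDensity_rnDeriv_eq m volume h1]
    calc _ ≤ volume.withDensity 1 := withDensity_mono h2
      _ = volume := withDensity_one
  · intro h
    exact ⟨Measure.absolutelyContinuous_of_le h, Measure.rnDeriv_le_one_of_le h⟩

/-- A sequence of probability measures on a compact interval has a subsequence whose moments
converge to those of a probability measure on this interval. -/
theorem exists_subseq_tendsto_moment {m : ℕ → CompactProb} {C : ℝ}
    (hm : ∀ j, ∀ᵐ x ∂(m j).1, |x| ≤ C) :
    ∃ (φ : ℕ → ℕ) (m' : CompactProb), StrictMono φ ∧ (∀ᵐ x ∂m'.1, |x| ≤ C) ∧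
      (∀ k, Tendsto (fun j => moment (m (φ j)) k) atTop (𝓝 (moment m' k))) ∧
      ((∀ j, (m j).1 ≤ volume) → m'.1 ≤ volume) := by
  let P : ℕ → ProbabilityMeasure ℝ := fun j => ⟨(m j).1, (m j).2.1⟩
  have htight : IsTightMeasureSet {((μ : ProbabilityMeasure ℝ) : Measure ℝ) | μ ∈ Set.range P} := by
    rw [isTightMeasureSet_iff_exists_isCompact_measure_compl_le]
    intro ε _
    refine ⟨Set.Icc (-C) C, isCompact_Icc, ?_⟩
    rintro _ ⟨_, ⟨j, rfl⟩, rfl⟩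
    have : (m j).1 (Set.Icc (-C) C)ᶜ = 0 :=
      measure_mono_null (fun x hx hx' => hx (abs_le.1 hx')) (hm j)
    exact this.le.trans zero_le
  obtain ⟨P', -, φ, hφ, hlim⟩ := (isCompact_closure_of_isTightMeasureSet htight).tendsto_subseq
    (x := P) (fun n => subset_closure ⟨n, rfl⟩)
  -- The portmanteau inequality for open sets gives both the support bound and, through outer
  -- regularity of Lebesgue measure, the density bound of the limit.
  have hopen : ∀ U : Set ℝ, IsOpen U → (P' : Measure ℝ) U ≤ atTop.liminf fun j => (m (φ j)).1 U :=
    fun U hU => ProbabilityMeasure.le_liminf_measure_open_of_tendsto hlim hU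
  have hsupp : ∀ᵐ x ∂(P' : Measure ℝ), |x| ≤ C := by
    have hU : IsOpen {x : ℝ | ¬ |x| ≤ C} := by
      simpa only [not_le] using isOpen_lt continuous_const continuous_abs
    have h0 := hopen _ hU
    have h1 : (fun j => (m (φ j)).1 {x : ℝ | ¬ |x| ≤ C}) = fun _ => 0 := funext fun j => hm _
    rw [h1, liminf_const] at h0
    exact le_antisymm h0 zero_le
  refine ⟨φ, ⟨P', inferInstance, hasCompactSupp_iff.2 ⟨C, hsupp⟩⟩, hφ, hsupp,
    fun k => ?_, fun h => ?_⟩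
  -- Monomials are unbounded, so they are composed with the truncation to [-C, C], which changes
  -- nothing almost everywhere.
  · let f : BoundedContinuousFunction ℝ ℝ := BoundedContinuousFunction.ofNormedAddCommGroup
      (fun x => (max (-C) (min C x)) ^ k) (by fun_prop) (|C| ^ k) (by
        intro x
        rw [norm_pow, Real.norm_eq_abs]
        refine pow_le_pow_left₀ (abs_nonneg _) ?_ k
        rw [abs_le]
        constructor
        · exact (neg_le_neg (le_abs_self C)).trans (le_max_left _ _)
        · exact max_le (neg_le_abs C) ((min_le_left _ _).trans (le_abs_self C)))
    have hf : ∀ μ : Measure ℝ, (∀ᵐ x ∂μ, |x| ≤ C) → ∫ x, f x ∂μ = ∫ x, x ^ k ∂μ := by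
      intro μ hμ
      refine integral_congr_ae ?_
      filter_upwards [hμ] with x hx
      have hx' := abs_le.1 hx
      change (max (-C) (min C x)) ^ k = x ^ k
      rw [min_eq_right hx'.2, max_eq_right hx'.1]
    have := ProbabilityMeasure.tendsto_iff_forall_integral_tendsto.1 hlim f
    rw [hf _ hsupp] at this
    refine this.congr fun j => ?_
    exact hf _ (hm _)
  · have hU : ∀ U : Set ℝ, IsOpen U → (P' : Measure ℝ) U ≤ volume U := by
      intro U hU
      refine (hopen U hU).trans ?_
      refine (liminf_le_liminf (v := fun _ : ℕ => (volume : Measure ℝ) U)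
        (Eventually.of_forall fun j => h _ U)).trans ?_
      rw [liminf_const]
    refine Measure.le_intro fun A _ _ => ?_
    rw [A.measure_eq_iInf_isOpen volume]
    refine le_iInf fun U => le_iInf fun hAU => le_iInf fun hUo => ?_
    exact (measure_mono hAU).trans (hU U hUo)

/-- Empirical moments of a suitable sequence of points converge to the moments of the measure. -/
theorem exists_tendsto_empirical_moment (m : CompactProb) {C : ℝ} (hC : ∀ᵐ x ∂m.1, |x| ≤ C) :
    ∃ a : ℕ → ℝ, (∀ i, |a i| ≤ C) ∧
      ∀ k, Tendsto (fun n : ℕ => (∑ i ∈ Finset.range n, a i ^ k) / n) atTop (𝓝 (moment m k)) := by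
  obtain ⟨Ω, _, P, X, hX, hlaw, hind, hP⟩ := ProbabilityTheory.exists_iid ℕ m.1
  have hbd : ∀ i, ∀ᵐ ω ∂P, |X i ω| ≤ C := by
    intro i
    have := hC
    rw [← (hlaw i).map_eq] at this
    exact ae_of_ae_map (hX i).aemeasurable this
  have hlim : ∀ k : ℕ, ∀ᵐ ω ∂P, Tendsto (fun n : ℕ => (∑ i ∈ Finset.range n, X i ω ^ k) / n) atTop
      (𝓝 (moment m k)) := by
    intro k
    have hpow : Measurable fun x : ℝ => x ^ k := measurable_id.pow_const k
    have hmom : ∫ ω, X 0 ω ^ k ∂P = moment m k := by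
      rw [moment, ← (hlaw 0).map_eq, integral_map (hX 0).aemeasurable hpow.aestronglyMeasurable]
    rw [← hmom]
    refine ProbabilityTheory.strong_law_ae_real (fun i ω => X i ω ^ k) ?_ ?_ ?_
    · have := integrable_pow_of_ae_abs_le hC k
      rw [← (hlaw 0).map_eq] at this
      exact this.comp_measurable (hX 0)
    · intro i j hij
      exact (hind.indepFun hij).comp hpow hpow
    · intro i
      exact ((hlaw i).identDistrib (hlaw 0)).comp hpow
  -- The law of large numbers holds for all powers simultaneously outside one null set; any
  -- remaining sample point will do.
  obtain ⟨ω, h1, h2⟩ := ((ae_all_iff.2 hbd).and (ae_all_iff.2 hlim)).exists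
  exact ⟨fun i => X i ω, h1, h2⟩

/-- Rounding down to a multiple of `1 / (n + 1)`. -/
noncomputable def gridFloor (n : ℕ) (x : ℝ) : ℝ :=
  ⌊(n + 1 : ℝ) * x⌋ / (n + 1 : ℝ)

theorem measurable_gridFloor (n : ℕ) : Measurable (gridFloor n) := by
  unfold gridFloor
  fun_prop

theorem abs_sub_gridFloor_le (n : ℕ) (x : ℝ) : |x - gridFloor n x| ≤ 1 / (n + 1 : ℝ) := by
  have hn : (0 : ℝ) < n + 1 := by positivity
  have h1 := Int.floor_le ((n + 1 : ℝ) * x)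
  have h2 := Int.lt_floor_add_one ((n + 1 : ℝ) * x)
  have h3 : x - gridFloor n x = ((n + 1 : ℝ) * x - ⌊(n + 1 : ℝ) * x⌋) / (n + 1 : ℝ) := by
    rw [gridFloor]
    field_simp
  rw [h3, abs_of_nonneg (div_nonneg (by linarith) hn.le)]
  gcongr
  linarith

theorem abs_gridFloor_le {n : ℕ} {x C : ℝ} (h : |x| ≤ C) : |gridFloor n x| ≤ C + 1 := by
  have h1 := abs_sub_gridFloor_le n x
  have h2 : (1 : ℝ) / (n + 1) ≤ 1 := by
    rw [div_le_one (by positivity)]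
    linarith [n.cast_nonneg (α := ℝ)]
  calc |gridFloor n x| = |x - (x - gridFloor n x)| := by ring_nf
    _ ≤ |x| + |x - gridFloor n x| := abs_sub _ _
    _ ≤ C + 1 := by linarith

/-- The error is at most k (C + 1)^(k - 1) / (n + 1) whatever the measure, so the measure may vary
with n. -/
theorem tendsto_integral_pow_sub_gridFloor {m : ℕ → CompactProb} {C : ℝ}
    (hm : ∀ n, ∀ᵐ x ∂(m n).1, |x| ≤ C) (k : ℕ) :
    Tendsto (fun n => moment (m n) k - ∫ x, gridFloor n x ^ k ∂(m n).1) atTop (𝓝 0) := by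
  have hC : 0 ≤ C := by
    obtain ⟨x, hx⟩ := (hm 0).exists
    exact (abs_nonneg x).trans hx
  have hb : ∀ n, ‖moment (m n) k - ∫ x, gridFloor n x ^ k ∂(m n).1‖
      ≤ k * (C + 1) ^ (k - 1) * (1 / ((n : ℝ) + 1)) := by
    intro n
    have hg : Integrable (fun x => gridFloor n x ^ k) (m n).1 := by
      refine Integrable.of_bound
        ((measurable_gridFloor n).pow_const k).aestronglyMeasurable ((C + 1) ^ k) ?_
      filter_upwards [hm n] with x hx
      rw [norm_pow, Real.norm_eq_abs]
      gcongr
      exact abs_gridFloor_le hx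
    rw [moment, ← integral_sub (integrable_pow_of_ae_abs_le (hm n) k) hg]
    have := norm_integral_le_of_norm_le_const (μ := (m n).1)
      (f := fun x => x ^ k - gridFloor n x ^ k)
      (C := k * (C + 1) ^ (k - 1) * (1 / ((n : ℝ) + 1))) (by
        filter_upwards [hm n] with x hx
        rw [Real.norm_eq_abs]
        refine (abs_pow_sub_pow_le ..).trans ?_
        have h1 := abs_sub_gridFloor_le n x
        have h2 : max |x| |gridFloor n x| ≤ C + 1 := max_le (by linarith) (abs_gridFloor_le hx)
        calc _ ≤ (1 / ((n : ℝ) + 1)) * k * (C + 1) ^ (k - 1) := by gcongr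
          _ = _ := by ring)
    simpa using this
  refine squeeze_zero_norm hb ?_
  simpa using (tendsto_one_div_add_atTop_nhds_zero_nat (𝕜 := ℝ)).const_mul
    ((k : ℝ) * (C + 1) ^ (k - 1))

section Discrete

variable {ι : Type*} [Fintype ι]

/-- The measure with mass `w i` at `y i`. -/
noncomputable def weightedDirac (w y : ι → ℝ) : Measure ℝ :=
  ∑ i, ENNReal.ofReal (w i) • Measure.dirac (y i)

theorem ae_weightedDirac {w y : ι → ℝ} {p : ℝ → Prop} (h : ∀ i, p (y i)) :
    ∀ᵐ x ∂weightedDirac w y, p x := by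
  rw [weightedDirac, ae_iff, Measure.finsetSum_apply]
  refine Finset.sum_eq_zero fun i _ => ?_
  have : ∀ᵐ x ∂Measure.dirac (y i), p x := by
    rw [ae_dirac_eq]
    exact h i
  rw [Measure.smul_apply, ae_iff.1 this, smul_zero]

theorem integral_weightedDirac {w : ι → ℝ} (hw : ∀ i, 0 ≤ w i) (y : ι → ℝ) (f : ℝ → ℝ) :
    ∫ x, f x ∂weightedDirac w y = ∑ i, w i * f (y i) := by
  rw [weightedDirac, integral_finsetSum_measure]
  · refine Finset.sum_congr rfl fun i _ => ?_
    rw [integral_smul_measure, integral_dirac, ENNReal.toReal_ofReal (hw i), smul_eq_mul]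
  · intro i _
    exact (integrable_dirac (by simp)).smul_measure ENNReal.ofReal_ne_top

/-- The probability measure with mass `w i` at `y i`. -/
noncomputable def discreteProb (w y : ι → ℝ) (hw : ∀ i, 0 ≤ w i) (h1 : ∑ i, w i = 1) :
    CompactProb :=
  ⟨weightedDirac w y, ⟨by
    simp only [weightedDirac, Measure.finsetSum_apply, Measure.smul_apply, measure_univ,
      smul_eq_mul, mul_one]
    rw [← ENNReal.ofReal_sum_of_nonneg fun i _ => hw i, h1, ENNReal.ofReal_one]⟩,
    hasCompactSupp_iff.2 ⟨∑ i, |y i|, ae_weightedDirac fun i =>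
      Finset.single_le_sum (f := fun i => |y i|) (fun i _ => abs_nonneg _) (Finset.mem_univ i)⟩⟩

theorem ae_discreteProb {w y : ι → ℝ} (hw : ∀ i, 0 ≤ w i) (h1 : ∑ i, w i = 1) {p : ℝ → Prop}
    (h : ∀ i, p (y i)) : ∀ᵐ x ∂(discreteProb w y hw h1).1, p x :=
  ae_weightedDirac h

theorem moment_discreteProb {w y : ι → ℝ} (hw : ∀ i, 0 ≤ w i) (h1 : ∑ i, w i = 1) (k : ℕ) :
    moment (discreteProb w y hw h1) k = ∑ i, w i * y i ^ k :=
  integral_weightedDirac hw y fun x => x ^ k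

end Discrete

end Measures

/-! ### Resolvents over noncommutative algebras and additivity of the R-transform. -/

section NoncommutativeSeries

theorem exists_inverse_one_sub {A : Type*} [Ring A] {f : A⟦X⟧} (hf : f.constantCoeff = 0) :
    ∃ r : A⟦X⟧, (1 - f) * r = 1 ∧ r * (1 - f) = 1 :=
  ⟨PowerSeries.invOfUnit (1 - f) 1, PowerSeries.mul_invOfUnit _ _ (by simp [hf]),
    PowerSeries.invOfUnit_mul _ _ (by simp [hf])⟩

theorem coeff_pow_mul_eq_zero {A : Type*} [Ring A] {f : A⟦X⟧} (hf : f.constantCoeff = 0)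
    {m n : ℕ} (h : n < m)
    (g : A⟦X⟧) : (f ^ m * g).coeff n = 0 := by
  induction m generalizing n with
  | zero => omega
  | succ m ih =>
    rw [pow_succ', mul_assoc, PowerSeries.coeff_mul]
    refine Finset.sum_eq_zero fun p hp => ?_
    have := Finset.HasAntidiagonal.mem_antidiagonal.1 hp
    rcases Nat.eq_zero_or_pos p.1 with h0 | h0
    · rw [h0, PowerSeries.coeff_zero_eq_constantCoeff_apply, hf, zero_mul]
    · rw [ih (by omega), mul_zero]

/-- The inverse of 1 - f is the geometric series in f, and powers beyond n do not reach the n-th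
coefficient. -/
theorem coeff_eq_sum_coeff_pow {A : Type*} [Ring A] {f r : A⟦X⟧} (hf : f.constantCoeff = 0)
    (h : (1 - f) * r = 1)
    (n : ℕ) : r.coeff n = ∑ k ∈ Finset.range (n + 1), (f ^ k).coeff n := by
  have h1 : ∑ k ∈ Finset.range (n + 1), f ^ k = r - f ^ (n + 1) * r := by
    have := congrArg (· * r) (geom_sum_mul_neg f (n + 1))
    simpa only [mul_assoc, h, mul_one, sub_mul, one_mul] using this
  have h2 := congrArg (PowerSeries.coeff n) h1
  rw [map_sub, coeff_pow_mul_eq_zero hf (Nat.lt_succ_self n), sub_zero, map_sum] at h2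
  exact h2.symm

variable {A : Type*} [Ring A] [Algebra ℝ A]

/-- Scalar power series as power series with coefficients in an algebra. -/
noncomputable def scalarSeries (A : Type*) [Ring A] [Algebra ℝ A] : ℝ⟦X⟧ →+* A⟦X⟧ :=
  PowerSeries.map (algebraMap ℝ A)

theorem coeff_scalarSeries (u : ℝ⟦X⟧) (n : ℕ) :
    (scalarSeries A u).coeff n = algebraMap ℝ A (u.coeff n) := rfl

theorem scalarSeries_X : scalarSeries A PowerSeries.X = PowerSeries.X :=
  PowerSeries.map_X _

theorem scalarSeries_commute (u : ℝ⟦X⟧) (f : A⟦X⟧) : Commute (scalarSeries A u) f := by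
  ext n
  rw [PowerSeries.coeff_mul, PowerSeries.coeff_mul, ← Finset.Nat.sum_antidiagonal_swap]
  refine Finset.sum_congr rfl fun p _ => ?_
  simp only [Prod.fst_swap, Prod.snd_swap, coeff_scalarSeries]
  exact Algebra.commutes _ _

/-- The coefficientwise extension of a linear functional to power series. -/
noncomputable def mapFunctional (τ : A →ₗ[ℝ] ℝ) : A⟦X⟧ →+ ℝ⟦X⟧ where
  toFun f := PowerSeries.mk fun n => τ (f.coeff n)
  map_zero' := by ext; simp
  map_add' f g := by ext; simp

theorem coeff_mapFunctional (τ : A →ₗ[ℝ] ℝ) (f : A⟦X⟧) (n : ℕ) :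
    (mapFunctional τ f).coeff n = τ (f.coeff n) :=
  PowerSeries.coeff_mk n fun n => τ (f.coeff n)

theorem mapFunctional_scalarSeries_mul (τ : A →ₗ[ℝ] ℝ) (u : ℝ⟦X⟧) (f : A⟦X⟧) :
    mapFunctional τ (scalarSeries A u * f) = u * mapFunctional τ f := by
  ext n
  simp only [coeff_mapFunctional, PowerSeries.coeff_mul, coeff_scalarSeries, map_sum,
    ← Algebra.smul_def, map_smul, smul_eq_mul]

theorem mapFunctional_one {τ : A →ₗ[ℝ] ℝ} (h : τ 1 = 1) : mapFunctional τ 1 = 1 := by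
  ext n
  rw [coeff_mapFunctional, PowerSeries.coeff_one, PowerSeries.coeff_one]
  split_ifs <;> simp [h]

/-- The generating series of the moments of `x`, evaluated at `u`, is the functional applied to
the resolvent of `x`. -/
theorem mapFunctional_resolvent (τ : A →ₗ[ℝ] ℝ) {u : ℝ⟦X⟧} (hu : u.constantCoeff = 0) (x : A)
    {r : A⟦X⟧} (h : (1 - scalarSeries A u * PowerSeries.C x) * r = 1) :
    mapFunctional τ r = (PowerSeries.mk fun k => τ (x ^ k)).subst u := by
  ext n
  rw [coeff_subst_eq_sum hu, coeff_mapFunctional, coeff_eq_sum_coeff_pow _ h, map_sum]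
  · refine Finset.sum_congr rfl fun k _ => ?_
    rw [(scalarSeries_commute u _).mul_pow, ← map_pow, ← map_pow, PowerSeries.coeff_mul_C,
      coeff_scalarSeries, ← Algebra.smul_def, map_smul, PowerSeries.coeff_mk, smul_eq_mul, mul_comm]
  · rw [map_mul, ← PowerSeries.coeff_zero_eq_constantCoeff_apply, coeff_scalarSeries,
      PowerSeries.coeff_zero_eq_constantCoeff_apply, hu, map_zero, zero_mul]

/-- The power series all of whose coefficients belong to `W`. -/
def seriesIn (W : Submodule ℝ A) : AddSubgroup A⟦X⟧ where
  carrier := {f | ∀ n, f.coeff n ∈ W}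
  zero_mem' n := by simp
  add_mem' hf hg n := by simpa using W.add_mem (hf n) (hg n)
  neg_mem' hf n := by simpa using hf n

theorem mul_mem_seriesIn {W₁ W₂ W : Submodule ℝ A} (h : ∀ a ∈ W₁, ∀ b ∈ W₂, a * b ∈ W)
    {f g : A⟦X⟧} (hf : f ∈ seriesIn W₁) (hg : g ∈ seriesIn W₂) : f * g ∈ seriesIn W := by
  intro n
  rw [PowerSeries.coeff_mul]
  exact W.sum_mem fun p _ => h _ (hf _) _ (hg _)

theorem mapFunctional_eq_zero {τ : A →ₗ[ℝ] ℝ} {W : Submodule ℝ A} (h : ∀ a ∈ W, τ a = 0)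
    {f : A⟦X⟧} (hf : f ∈ seriesIn W) : mapFunctional τ f = 0 := by
  ext n
  rw [coeff_mapFunctional, h _ (hf n), map_zero]

/-- Subspaces of words in two families of centered elements that begin with the family `i` and
end with the family `j`. -/
structure AlternatingSpaces (τ : A →ₗ[ℝ] ℝ) (W : Bool → Bool → Submodule ℝ A) : Prop where
  functional_one : τ 1 = 1
  functional_eq_zero : ∀ i j, ∀ a ∈ W i j, τ a = 0
  mul_mem_of_ne : ∀ i j k l, j ≠ k → ∀ a ∈ W i j, ∀ b ∈ W k l, a * b ∈ W i l

variable {τ : A →ₗ[ℝ] ℝ} {W : Bool → Bool → Submodule ℝ A}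

/-- Expanding r as the geometric series in ab writes the product as 1 plus alternating words in a
and b, all of which the functional kills. -/
theorem AlternatingSpaces.mapFunctional_eq_one (hW : AlternatingSpaces τ W) {a b r : A⟦X⟧}
    (ha : a ∈ seriesIn (W true true)) (hb : b ∈ seriesIn (W false false))
    (ha0 : a.constantCoeff = 0) (h : (1 - a * b) * r = 1) :
    mapFunctional τ ((1 + b) * r * (1 + a)) = 1 := by
  have hab : a * b ∈ seriesIn (W true false) :=
    mul_mem_seriesIn (hW.mul_mem_of_ne _ _ _ _ (by decide)) ha hb
  have hpow : ∀ k : ℕ, (a * b) ^ (k + 1) ∈ seriesIn (W true false) := by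
    intro k
    induction k with
    | zero => simpa using hab
    | succ k ih =>
      rw [pow_succ]
      exact mul_mem_seriesIn (hW.mul_mem_of_ne _ _ _ _ (by decide)) ih hab
  have hr : r - 1 ∈ seriesIn (W true false) := by
    intro n
    rw [map_sub, coeff_eq_sum_coeff_pow (by simp [ha0]) h, Finset.sum_range_succ', pow_zero,
      add_sub_cancel_right]
    exact Submodule.sum_mem _ fun k _ => hpow k n
  have h1 : b + b * (r - 1) ∈ seriesIn (W false false) :=
    add_mem hb (mul_mem_seriesIn (hW.mul_mem_of_ne _ _ _ _ (by decide)) hb hr)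
  have h2 : a + (r - 1) * a ∈ seriesIn (W true true) :=
    add_mem ha (mul_mem_seriesIn (hW.mul_mem_of_ne _ _ _ _ (by decide)) hr ha)
  have h3 : (b + b * (r - 1)) * a ∈ seriesIn (W false true) :=
    mul_mem_seriesIn (hW.mul_mem_of_ne _ _ _ _ (by decide)) h1 ha
  have h4 : (1 + b) * r * (1 + a)
      = 1 + (r - 1) + (b + b * (r - 1)) + (a + (r - 1) * a) + (b + b * (r - 1)) * a := by
    noncomm_ring
  rw [h4, map_add, map_add, map_add, map_add, mapFunctional_one hW.functional_one,
    mapFunctional_eq_zero (hW.functional_eq_zero _ _) hr, mapFunctional_eq_zero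
      (hW.functional_eq_zero _ _) h1,
    mapFunctional_eq_zero (hW.functional_eq_zero _ _) h2, mapFunctional_eq_zero
      (hW.functional_eq_zero _ _) h3]
  simp

theorem constantCoeff_X_mul (v : ℝ⟦X⟧) : (PowerSeries.X * v).constantCoeff = 0 := by simp

/-- With the inverse moment series written as zv, the series v (1 - zvx)⁻¹ is the inverse of v⁻¹ -
zx, and the hypothesis on v says exactly that the functional sends it to 1. Hence it is 1 + c with c
centered. -/
theorem exists_centered_resolvent {B : Type*} [Ring B] [Algebra ℝ B] (σ : B →ₗ[ℝ] ℝ)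
    (j : B →ₐ[ℝ] A) {W : Submodule ℝ A} (hj : ∀ b, σ b = 0 → j b ∈ W) (h1 : σ 1 = 1) (x : B)
    {v : ℝ⟦X⟧} (hv : v.constantCoeff = 1)
    (h : v * (PowerSeries.mk fun k => σ (x ^ k)).subst (PowerSeries.X * v) = 1) :
    ∃ c : A⟦X⟧, c ∈ seriesIn W ∧ c.constantCoeff = 0 ∧
      (scalarSeries A v⁻¹ - PowerSeries.X * PowerSeries.C (j x)) * (1 + c) = 1 ∧
      (1 + c) * (scalarSeries A v⁻¹ - PowerSeries.X * PowerSeries.C (j x)) = 1 := by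
  have hvi : v⁻¹ * v = 1 := PowerSeries.inv_mul_cancel _ (by simp [hv])
  have hcc : (scalarSeries B (PowerSeries.X * v) * PowerSeries.C x).constantCoeff = 0 := by
    rw [map_mul, map_mul, scalarSeries_X]
    simp
  obtain ⟨r, hr1, hr2⟩ := exists_inverse_one_sub hcc
  have hτ := mapFunctional_resolvent σ (constantCoeff_X_mul v) x hr1
  have hr0 : r.constantCoeff = 1 := by
    have := congrArg PowerSeries.constantCoeff hr1
    rwa [map_mul, map_sub, hcc, map_one, sub_zero, one_mul] at this
  have hd : scalarSeries B v⁻¹ - PowerSeries.X * PowerSeries.C x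
      = scalarSeries B v⁻¹ * (1 - scalarSeries B (PowerSeries.X * v) * PowerSeries.C x) := by
    rw [mul_sub, mul_one, ← mul_assoc, ← map_mul, mul_left_comm, hvi, mul_one, scalarSeries_X]
  have hs1 : scalarSeries B v⁻¹ * scalarSeries B v = 1 := by rw [← map_mul, hvi, map_one]
  have e1 : (scalarSeries B v⁻¹ - PowerSeries.X * PowerSeries.C x) *
      (scalarSeries B v * r) = 1 := by
    rw [hd, mul_assoc, ← mul_assoc _ (scalarSeries B v) r, ← (scalarSeries_commute v _).eq,
      mul_assoc, hr1, mul_one, hs1]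
  have e2 : (scalarSeries B v * r) * (scalarSeries B v⁻¹ - PowerSeries.X * PowerSeries.C x)
      = 1 := by
    rw [hd, (scalarSeries_commute v r).eq, mul_assoc, ← mul_assoc (scalarSeries B v), ← map_mul,
      mul_comm v, hvi, map_one, one_mul, hr2]
  let φ : B⟦X⟧ →+* A⟦X⟧ := PowerSeries.map (j : B →+* A)
  have hφs : ∀ u : ℝ⟦X⟧, φ (scalarSeries B u) = scalarSeries A u := by
    intro u
    ext n
    simp only [φ, PowerSeries.coeff_map, coeff_scalarSeries]
    exact j.commutes _
  have hφd : φ (scalarSeries B v⁻¹ - PowerSeries.X * PowerSeries.C x)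
      = scalarSeries A v⁻¹ - PowerSeries.X * PowerSeries.C (j x) := by
    rw [map_sub, map_mul, hφs]
    simp [φ]
  refine ⟨φ (scalarSeries B v * r - 1), ?_, ?_, ?_, ?_⟩
  · intro n
    simp only [φ, PowerSeries.coeff_map]
    refine hj _ ?_
    rw [← coeff_mapFunctional, map_sub, mapFunctional_scalarSeries_mul, hτ, h,
      mapFunctional_one h1, sub_self, map_zero]
  · have : (scalarSeries B v * r - 1).constantCoeff = 0 := by
      rw [map_sub, map_mul, hr0, ← PowerSeries.coeff_zero_eq_constantCoeff_apply,
        coeff_scalarSeries, PowerSeries.coeff_zero_eq_constantCoeff_apply, hv]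
      simp
    rw [← PowerSeries.coeff_zero_eq_constantCoeff_apply] at this ⊢
    simp only [φ, PowerSeries.coeff_map, this, map_zero]
  · rw [map_sub φ, map_one, add_sub_cancel, ← hφd, ← map_mul, e1, map_one]
  · rw [map_sub φ, map_one, add_sub_cancel, ← hφd, ← map_mul, e2, map_one]

/-- Additivity of the `R`-transform for the sum of two free elements. -/
theorem AlternatingSpaces.subst_add_eq_one (hW : AlternatingSpaces τ W)
    {B : Bool → Type*} [∀ i, Ring (B i)] [∀ i, Algebra ℝ (B i)] (σ : ∀ i, B i →ₗ[ℝ] ℝ)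
    (j : ∀ i, B i →ₐ[ℝ] A) (hj : ∀ i b, σ i b = 0 → j i b ∈ W i i) (h1 : ∀ i, σ i 1 = 1)
    (x : ∀ i, B i) {v : Bool → ℝ⟦X⟧} (hv : ∀ i, (v i).constantCoeff = 1)
    (h : ∀ i, v i * (PowerSeries.mk fun k => σ i (x i ^ k)).subst (PowerSeries.X * v i) = 1) :
    ((v true)⁻¹ + (v false)⁻¹ - 1)⁻¹ *
      (PowerSeries.mk fun k => τ ((j true (x true) + j false (x false)) ^ k)).subst
        (PowerSeries.X * ((v true)⁻¹ + (v false)⁻¹ - 1)⁻¹) = 1 := by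
  obtain ⟨a, ha, ha0, ha1, ha2⟩ := exists_centered_resolvent (σ true) (j true) (hj true) (h1 true)
    (x true) (hv true) (h true)
  obtain ⟨b, hb, hb0, hb1, hb2⟩ := exists_centered_resolvent (σ false) (j false) (hj false)
    (h1 false) (x false) (hv false) (h false)
  obtain ⟨r, hr1, -⟩ := exists_inverse_one_sub (f := a * b) (by simp [ha0])
  have hone := hW.mapFunctional_eq_one ha hb ha0 hr1
  -- Each v⁻¹ equals 1 + zR(z), so w is 1 + z(R₁ + R₂), the candidate for the sum.
  set w : ℝ⟦X⟧ := (v true)⁻¹ + (v false)⁻¹ - 1 with hw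
  have hwi : w⁻¹ * w = 1 := PowerSeries.inv_mul_cancel _ (by simp [hw, hv])
  set d₁ : A⟦X⟧ := scalarSeries A (v true)⁻¹ - PowerSeries.X * PowerSeries.C (j true (x true))
    with hd₁
  set d₂ : A⟦X⟧ := scalarSeries A (v false)⁻¹ - PowerSeries.X * PowerSeries.C (j false (x false))
    with hd₂
  have key : (d₁ + d₂ - 1) * ((1 + b) * r * (1 + a)) = 1 := by
    -- As 1 + a and 1 + b invert d₁ and d₂, the left side is (1 + b) + (1 + a) - (1 + a)(1 + b).
    -- This exhibits the resolvent of the sum as (1 + b)(1 - ab)⁻¹(1 + a).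
    have e1 : (1 + a) * (d₁ + d₂ - 1) * (1 + b) = 1 - a * b := by
      calc _ = ((1 + a) * d₁) * (1 + b) + (1 + a) * (d₂ * (1 + b)) - (1 + a) * (1 + b) := by
            noncomm_ring
        _ = _ := by
            rw [ha2, hb1]
            noncomm_ring
    have e2 : (d₁ + d₂ - 1) * (1 + b) * r = d₁ := by
      calc _ = d₁ * ((1 + a) * (d₁ + d₂ - 1) * (1 + b)) * r := by
            simp only [← mul_assoc, ha1, one_mul]
        _ = d₁ := by rw [e1, mul_assoc, hr1, mul_one]
    rw [← mul_assoc, ← mul_assoc, e2, ha1]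
  have hd : d₁ + d₂ - 1 = scalarSeries A w
      - PowerSeries.X * PowerSeries.C (j true (x true) + j false (x false)) := by
    rw [hd₁, hd₂, hw, map_sub, map_add, map_one, map_add]
    noncomm_ring
  have hres : (1 - scalarSeries A (PowerSeries.X * w⁻¹) *
      PowerSeries.C (j true (x true) + j false (x false))) *
      (scalarSeries A w * ((1 + b) * r * (1 + a))) = 1 := by
    have e3 : 1 - scalarSeries A (PowerSeries.X * w⁻¹) *
        PowerSeries.C (j true (x true) + j false (x false))
        = scalarSeries A w⁻¹ * (d₁ + d₂ - 1) := by
      rw [hd, mul_sub, ← map_mul, hwi, map_one, ← mul_assoc, mul_comm PowerSeries.X, map_mul,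
        scalarSeries_X]
    rw [e3, mul_assoc, ← mul_assoc _ (scalarSeries A w), ← (scalarSeries_commute w _).eq,
      mul_assoc (scalarSeries A w), key, mul_one, ← map_mul, hwi, map_one]
  rw [← mapFunctional_resolvent τ (constantCoeff_X_mul _) _ hres, mapFunctional_scalarSeries_mul,
    hone, mul_one, hwi]

end NoncommutativeSeries

/-! ### Spectral measures of bounded symmetric operators. -/

section SpectralMeasure

variable {E : Type*} [NormedAddCommGroup E] [InnerProductSpace ℝ E]

/-- The first moments of a bounded symmetric operator in a vector state are those of a finitely
supported measure. -/
theorem exists_compactProb_of_isSymmetric_of_le {T : E →ₗ[ℝ] E} (hT : T.IsSymmetric) {C : ℝ}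
    (hC : ∀ x, ‖T x‖ ≤ C * ‖x‖) {ξ : E} (hξ : ‖ξ‖ = 1) (N : ℕ) :
    ∃ τ : CompactProb, (∀ᵐ x ∂τ.1, |x| ≤ C) ∧
      ∀ k ≤ N, moment τ k = inner ℝ ((T ^ k) ξ) ξ := by
  let F : Submodule ℝ E := Submodule.span ℝ ((fun k => (T ^ k) ξ) '' Finset.range (N + 1))
  have : FiniteDimensional ℝ F :=
    FiniteDimensional.span_of_finite ℝ ((Finset.range (N + 1)).finite_toSet.image _)
  have hmem : ∀ k ≤ N, (T ^ k) ξ ∈ F := fun k hk =>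
    Submodule.subset_span ⟨k, by simpa using Nat.lt_succ_of_le hk, rfl⟩
  -- The compression of T to the span of ξ, Tξ, …, T^N ξ. It is symmetric in finite dimension, and
  -- its powers agree with those of T on ξ up to exponent N because these vectors never leave the
  -- span.
  let S : F →ₗ[ℝ] F := (F.orthogonalProjectionOnto : E →ₗ[ℝ] F) ∘ₗ T ∘ₗ F.subtype
  have hS : S.IsSymmetric := by
    intro x y
    have h1 : inner ℝ (S x) y = inner ℝ (T x) (y : E) :=
      F.inner_orthogonalProjectionOnto_eq_of_mem_right y (T x)
    have h2 : inner ℝ x (S y) = inner ℝ (x : E) (T y) :=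
      F.inner_orthogonalProjectionOnto_eq_of_mem_left x (T y)
    rw [h1, h2, hT]
  let ξ' : F := ⟨ξ, by simpa using hmem 0 (Nat.zero_le _)⟩
  have hpow : ∀ k ≤ N, (((S ^ k) ξ' : F) : E) = (T ^ k) ξ := by
    intro k
    induction k with
    | zero => intro _; simp [ξ']
    | succ k ih =>
      intro hk
      have h1 : (S ^ (k + 1)) ξ' = F.orthogonalProjectionOnto (T ((S ^ k) ξ' : F)) := by
        rw [pow_succ', Module.End.mul_apply]
        rfl
      rw [h1, ih (by omega), ← Module.End.mul_apply, ← pow_succ']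
      exact F.starProjection_eq_self_iff.2 (hmem _ hk)
  let b := hS.eigenvectorBasis rfl
  let l := hS.eigenvalues rfl
  have hb : ∀ i, S (b i) = l i • b i := fun i => hS.apply_eigenvectorBasis rfl i
  have hl : ∀ i, |l i| ≤ C := by
    intro i
    have hn : ‖b i‖ = 1 := b.norm_eq_one i
    have h1 : ‖S (b i)‖ ≤ ‖T (b i)‖ := F.norm_orthogonalProjectionOnto_apply_le _
    have h2 := hC (b i)
    rw [hb, norm_smul, hn, Real.norm_eq_abs, mul_one] at h1
    rw [← F.coe_norm, hn, mul_one] at h2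
    exact h1.trans h2
  have hrepr : ∀ k i, inner ℝ (b i) ((S ^ k) ξ') = l i ^ k * inner ℝ (b i) ξ' := by
    intro k i
    induction k with
    | zero => simp
    | succ k ih =>
      rw [pow_succ', Module.End.mul_apply, ← hS, hb, inner_smul_left, ih, pow_succ']
      simp [mul_assoc]
  have hmom : ∀ k, ∑ i, inner ℝ (b i) ξ' ^ 2 * l i ^ k = inner ℝ ((S ^ k) ξ') ξ' := by
    intro k
    rw [← b.sum_inner_mul_inner]
    refine Finset.sum_congr rfl fun i _ => ?_
    rw [real_inner_comm (b i) ((S ^ k) ξ'), hrepr]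
    ring
  have hsum : ∑ i, inner ℝ (b i) ξ' ^ 2 = 1 := by
    have := hmom 0
    simp only [pow_zero, mul_one, Module.End.one_apply] at this
    rw [this, real_inner_self_eq_norm_sq, F.coe_norm, hξ, one_pow]
  -- Atoms at the eigenvalues, weighted by the squared coordinates of ξ in the eigenbasis.
  refine ⟨discreteProb (fun i => inner ℝ (b i) ξ' ^ 2) l (fun i => sq_nonneg _) hsum,
    ae_discreteProb _ _ hl, fun k hk => ?_⟩
  rw [moment_discreteProb, hmom, ← hpow k hk]
  rfl

/-- The moments of a bounded symmetric operator in a vector state are those of a compactly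
supported measure. -/
theorem exists_compactProb_of_isSymmetric {T : E →ₗ[ℝ] E} (hT : T.IsSymmetric) {C : ℝ}
    (hC : ∀ x, ‖T x‖ ≤ C * ‖x‖) {ξ : E} (hξ : ‖ξ‖ = 1) :
    ∃ τ : CompactProb, (∀ᵐ x ∂τ.1, |x| ≤ C) ∧ ∀ k, moment τ k = inner ℝ ((T ^ k) ξ) ξ := by
  choose τ h1 h2 using exists_compactProb_of_isSymmetric_of_le hT hC hξ
  obtain ⟨φ, τ', hφ, h3, h4, -⟩ := exists_subseq_tendsto_moment h1
  refine ⟨τ', h3, fun k => tendsto_nhds_unique (h4 k) ?_⟩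
  refine tendsto_const_nhds.congr' ?_
  filter_upwards [eventually_ge_atTop k] with j hj
  exact (h2 _ k (hj.trans (hφ.id_le j))).symm

end SpectralMeasure

/-! ### Real group algebras as inner product spaces with a trace. -/

section GroupAlgebra

variable {G : Type*}

/-- The inner product on a real group algebra for which the group elements are orthonormal. -/
noncomputable def groupInner (a b : MonoidAlgebra ℝ G) : ℝ :=
  a.coeff.sum fun g r => r * b.coeff g

theorem groupInner_eq_sum {a : MonoidAlgebra ℝ G} (b : MonoidAlgebra ℝ G) {s : Finset G}
    (h : a.coeff.support ⊆ s) : groupInner a b = ∑ g ∈ s, a.coeff g * b.coeff g :=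
  Finsupp.sum_of_support_subset _ h _ (by simp)

theorem groupInner_add_left (a b c : MonoidAlgebra ℝ G) :
    groupInner (a + b) c = groupInner a c + groupInner b c := by
  rw [groupInner, MonoidAlgebra.coeff_add]
  exact Finsupp.sum_add_index' (by simp) (by intros; ring)

theorem groupInner_smul_left (r : ℝ) (a b : MonoidAlgebra ℝ G) :
    groupInner (r • a) b = r * groupInner a b := by
  rw [groupInner, MonoidAlgebra.coeff_smul, Finsupp.sum_smul_index (by simp), groupInner,
    Finsupp.mul_sum]
  simp only [mul_assoc]

theorem groupInner_comm (a b : MonoidAlgebra ℝ G) : groupInner a b = groupInner b a := by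
  classical
  rw [groupInner_eq_sum b (Finset.subset_union_left (s₂ := b.coeff.support)),
    groupInner_eq_sum a (Finset.subset_union_right (s₁ := a.coeff.support))]
  simp only [mul_comm]

theorem groupInner_self_nonneg (a : MonoidAlgebra ℝ G) : 0 ≤ groupInner a a := by
  rw [groupInner_eq_sum a subset_rfl]
  exact Finset.sum_nonneg fun g _ => mul_self_nonneg _

theorem eq_zero_of_groupInner_self {a : MonoidAlgebra ℝ G} (h : groupInner a a = 0) : a = 0 := by
  rw [groupInner_eq_sum a subset_rfl,
    Finset.sum_eq_zero_iff_of_nonneg fun g _ => mul_self_nonneg _] at h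
  rw [← MonoidAlgebra.coeff_eq_zero]
  ext g
  by_contra hg
  exact hg (mul_self_eq_zero.1 (h g (Finsupp.mem_support_iff.2 hg)))

theorem groupInner_single (g : G) (r : ℝ) (b : MonoidAlgebra ℝ G) :
    groupInner (MonoidAlgebra.single g r) b = r * b.coeff g := by
  rw [groupInner, MonoidAlgebra.coeff_single, Finsupp.sum_single_index (by simp)]

variable [Group G]

theorem groupInner_single_mul (g : G) (a b : MonoidAlgebra ℝ G) :
    groupInner (MonoidAlgebra.single g 1 * a) b
      = groupInner a (MonoidAlgebra.single g⁻¹ 1 * b) := by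
  induction a using MonoidAlgebra.induction_linear with
  | zero => simp [groupInner]
  | add x y hx hy => rw [mul_add, groupInner_add_left, groupInner_add_left, hx, hy]
  | single h r =>
    rw [MonoidAlgebra.single_mul_single, groupInner_single, groupInner_single,
      MonoidAlgebra.coeff_single_mul_apply]
    simp

/-- The linear span of the involutions in a real group algebra. -/
noncomputable def involutionSpan (G : Type*) [Group G] : Submodule ℝ (MonoidAlgebra ℝ G) :=
  Submodule.span ℝ {a | ∃ g : G, g * g = 1 ∧ MonoidAlgebra.single g 1 = a}

/-- The adjoint of left multiplication by g is that by g⁻¹, which equals g for an involution. -/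
theorem groupInner_mul_left {a : MonoidAlgebra ℝ G} (ha : a ∈ involutionSpan G)
    (x y : MonoidAlgebra ℝ G) : groupInner (a * x) y = groupInner x (a * y) := by
  induction ha using Submodule.span_induction with
  | mem a ha =>
    obtain ⟨g, hg, rfl⟩ := ha
    rw [groupInner_single_mul, inv_eq_of_mul_eq_one_left hg]
  | zero => simp [groupInner]
  | add a b _ _ h1 h2 =>
    rw [add_mul, add_mul, groupInner_add_left, h1, h2, groupInner_comm x, groupInner_comm x,
      groupInner_comm x, groupInner_add_left]
  | smul r a _ h =>
    rw [smul_mul_assoc, smul_mul_assoc, groupInner_smul_left, h, groupInner_comm x (r • _),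
      groupInner_smul_left, groupInner_comm x]

/-- The inner product space structure on a real group algebra. -/
@[reducible]
noncomputable def groupInnerCore (G : Type*) [Group G] :
    InnerProductSpace.Core ℝ (MonoidAlgebra ℝ G) where
  inner := groupInner
  conj_inner_symm a b := by simpa using groupInner_comm b a
  re_inner_nonneg a := by simpa using groupInner_self_nonneg a
  add_left := groupInner_add_left
  smul_left a b r := by simpa using groupInner_smul_left r a b
  definite _ := eq_zero_of_groupInner_self

/-- The canonical trace on a group algebra. -/
noncomputable def groupTrace (G : Type*) [Group G] : MonoidAlgebra ℝ G →ₗ[ℝ] ℝ where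
  toFun a := a.coeff 1
  map_add' a b := by simp
  map_smul' r a := by simp

theorem groupInner_one (a : MonoidAlgebra ℝ G) : groupInner a 1 = groupTrace G a := by
  rw [groupInner_comm, MonoidAlgebra.one_def, groupInner_single, one_mul]
  rfl

/-- The moments of a bounded self-adjoint element of a group algebra in the canonical trace are
those of a compactly supported measure. -/
theorem exists_compactProb_groupTrace {x : MonoidAlgebra ℝ G} (hx : x ∈ involutionSpan G) {C : ℝ}
    (hC0 : 0 ≤ C) (hC : ∀ a, groupInner (x * a) (x * a) ≤ C ^ 2 * groupInner a a) :
    ∃ τ : CompactProb, (∀ᵐ t ∂τ.1, |t| ≤ C) ∧ ∀ k, moment τ k = groupTrace G (x ^ k) := by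
  let : NormedAddCommGroup (MonoidAlgebra ℝ G) := (groupInnerCore G).toNormedAddCommGroup
  let : InnerProductSpace ℝ (MonoidAlgebra ℝ G) := InnerProductSpace.ofCore (groupInnerCore G).1
  have hinner : ∀ a b : MonoidAlgebra ℝ G, inner ℝ a b = groupInner a b := fun _ _ => rfl
  have hone : ‖(1 : MonoidAlgebra ℝ G)‖ = 1 := by
    rw [← sq_eq_sq₀ (norm_nonneg _) zero_le_one, ← real_inner_self_eq_norm_sq, hinner,
      groupInner_one, one_pow]
    exact MonoidAlgebra.coeff_one_one (R := ℝ) (M := G)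
  obtain ⟨τ, h1, h2⟩ := exists_compactProb_of_isSymmetric (T := LinearMap.mulLeft ℝ x)
    (fun a b => groupInner_mul_left hx a b) (C := C) (fun a => by
      refine le_of_sq_le_sq ?_ (mul_nonneg hC0 (norm_nonneg _))
      rw [mul_pow, ← real_inner_self_eq_norm_sq, ← real_inner_self_eq_norm_sq]
      exact hC a) hone
  refine ⟨τ, h1, fun k => ?_⟩
  rw [h2, hinner, groupInner_one, LinearMap.pow_mulLeft, LinearMap.mulLeft_apply, mul_one]

/-- Self-adjointness turns the relation into ‖xa‖² + ‖ya‖² = C² ‖a‖², so y witnesses the norm bound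
on x without any completion. -/
theorem groupInner_mul_le_of_sq {x y a : MonoidAlgebra ℝ G} {C : ℝ} (hx : x ∈ involutionSpan G)
    (hy : y ∈ involutionSpan G) (h : x * x + y * y = (C ^ 2) • 1) :
    groupInner (x * a) (x * a) ≤ C ^ 2 * groupInner a a := by
  have h1 : groupInner (x * a) (x * a) + groupInner (y * a) (y * a) = C ^ 2 * groupInner a a := by
    rw [groupInner_mul_left hx, groupInner_mul_left hy, ← mul_assoc, ← mul_assoc,
      groupInner_comm a, groupInner_comm a, ← groupInner_add_left, ← add_mul, h, smul_mul_assoc,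
      one_mul, groupInner_smul_left]
  linarith [groupInner_self_nonneg (y * a)]

theorem groupInner_add_mul_le {x y : MonoidAlgebra ℝ G} {C D : ℝ} (hC0 : 0 ≤ C) (hD0 : 0 ≤ D)
    (hx : ∀ a, groupInner (x * a) (x * a) ≤ C ^ 2 * groupInner a a)
    (hy : ∀ a, groupInner (y * a) (y * a) ≤ D ^ 2 * groupInner a a) (a : MonoidAlgebra ℝ G) :
    groupInner ((x + y) * a) ((x + y) * a) ≤ (C + D) ^ 2 * groupInner a a := by
  let : NormedAddCommGroup (MonoidAlgebra ℝ G) := (groupInnerCore G).toNormedAddCommGroup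
  let : InnerProductSpace ℝ (MonoidAlgebra ℝ G) := InnerProductSpace.ofCore (groupInnerCore G).1
  have hnorm : ∀ a : MonoidAlgebra ℝ G, groupInner a a = ‖a‖ ^ 2 := fun a =>
    real_inner_self_eq_norm_sq a
  have hx' := hx a
  have hy' := hy a
  rw [hnorm, hnorm, ← mul_pow] at hx' hy' ⊢
  have h1 := le_of_sq_le_sq hx' (mul_nonneg hC0 (norm_nonneg a))
  have h2 := le_of_sq_le_sq hy' (mul_nonneg hD0 (norm_nonneg a))
  refine pow_le_pow_left₀ (norm_nonneg _) ?_ 2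
  rw [add_mul]
  calc _ ≤ ‖x * a‖ + ‖y * a‖ := norm_add_le _ _
    _ ≤ (C + D) * ‖a‖ := by linarith

end GroupAlgebra

/-! ### Functions on 2^k points as the group algebra of {1, -1}^k. -/

section Idempotents

/-- The characters of the group `{1, -1}`. -/
noncomputable def signChar (s h : ℤˣ) : ℝ :=
  if s = -1 then ((h : ℤ) : ℝ) else 1

theorem signChar_mul (s h h' : ℤˣ) : signChar s (h * h') = signChar s h * signChar s h' := by
  unfold signChar
  split_ifs <;> simp

theorem sum_signChar_mul (s t : ℤˣ) :
    ∑ h, signChar s h * signChar t h = if s = t then 2 else 0 := by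
  have : (1 : ℤˣ) ≠ -1 := by decide
  rcases Int.units_eq_one_or s with rfl | rfl <;> rcases Int.units_eq_one_or t with rfl | rfl <;>
    norm_num [signChar, UnitsInt.univ, this, this.symm]

theorem sum_signChar (h : ℤˣ) : ∑ s, signChar s h = if h = 1 then 2 else 0 := by
  have : (1 : ℤˣ) ≠ -1 := by decide
  rcases Int.units_eq_one_or h with rfl | rfl <;>
    norm_num [signChar, UnitsInt.univ, this, this.symm]

/-- The group of `k`-tuples of signs. -/
abbrev SignGroup (k : ℕ) : Type := Fin k → ℤˣ

variable {k : ℕ}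

theorem SignGroup.mul_self (h : SignGroup k) : h * h = 1 := by
  ext i
  simp

/-- The characters of the group of sign tuples. -/
noncomputable def tupleChar (s h : SignGroup k) : ℝ :=
  ∏ i, signChar (s i) (h i)

theorem tupleChar_mul (s h h' : SignGroup k) :
    tupleChar s (h * h') = tupleChar s h * tupleChar s h' := by
  simp only [tupleChar, Pi.mul_apply, signChar_mul, Finset.prod_mul_distrib]

theorem tupleChar_one (s : SignGroup k) : tupleChar s 1 = 1 := by
  simp [tupleChar, signChar]

theorem sum_prod_eq_ite (f : Fin k → ℤˣ → ℝ) {s t : SignGroup k}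
    (h : ∀ i, ∑ x, f i x = if s i = t i then 2 else 0) :
    ∑ x : SignGroup k, ∏ i, f i (x i) = if s = t then 2 ^ k else 0 := by
  rw [← Fintype.piFinset_univ, ← Finset.prod_univ_sum]
  simp only [h]
  split_ifs with hst
  · simp [hst]
  · obtain ⟨i, hi⟩ := Function.ne_iff.1 hst
    exact Finset.prod_eq_zero (Finset.mem_univ i) (if_neg hi)

theorem sum_tupleChar_mul (s t : SignGroup k) :
    ∑ h, tupleChar s h * tupleChar t h = if s = t then 2 ^ k else 0 := by
  simp only [tupleChar, ← Finset.prod_mul_distrib]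
  exact sum_prod_eq_ite (fun i x => signChar (s i) x * signChar (t i) x)
    fun _ => sum_signChar_mul _ _

theorem sum_tupleChar (h : SignGroup k) : ∑ s, tupleChar s h = if h = 1 then 2 ^ k else 0 :=
  sum_prod_eq_ite (fun i x => signChar x (h i)) fun _ => sum_signChar _

/-- The minimal idempotents of the group algebra of the sign tuples. -/
noncomputable def signIdempotent (s : SignGroup k) : MonoidAlgebra ℝ (SignGroup k) :=
  ∑ h, MonoidAlgebra.single h ((2 ^ k)⁻¹ * tupleChar s h)

/-- Translating the summation index by g extracts a character value, which is its own inverse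
because all characters here are real. -/
theorem single_mul_signIdempotent (g s : SignGroup k) :
    MonoidAlgebra.single g (1 : ℝ) * signIdempotent s = tupleChar s g • signIdempotent s := by
  rw [signIdempotent, Finset.mul_sum, Finset.smul_sum]
  refine Fintype.sum_equiv (Equiv.mulLeft g) _ _ fun h => ?_
  rw [MonoidAlgebra.single_mul_single, MonoidAlgebra.smul_single, Equiv.coe_mulLeft, tupleChar_mul,
    smul_eq_mul, one_mul]
  have : tupleChar s g * tupleChar s g = 1 := by
    rw [← tupleChar_mul, SignGroup.mul_self, tupleChar_one]
  congr 1
  linear_combination (-(2 ^ k)⁻¹ * tupleChar s h) * this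

/-- Each group element in the first factor acts on the second by a character, so orthogonality of
characters decides the product. -/
theorem signIdempotent_mul (s t : SignGroup k) :
    signIdempotent s * signIdempotent t = if s = t then signIdempotent t else 0 := by
  have h1 : ∀ h : SignGroup k, MonoidAlgebra.single h ((2 ^ k)⁻¹ * tupleChar s h)
      = ((2 ^ k : ℝ)⁻¹ * tupleChar s h) • MonoidAlgebra.single h 1 := fun h => by
    rw [MonoidAlgebra.smul_single, smul_eq_mul, mul_one]
  rw [signIdempotent, Finset.sum_mul]
  simp only [h1, smul_mul_assoc, single_mul_signIdempotent, smul_smul]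
  rw [← Finset.sum_smul]
  simp only [mul_assoc]
  rw [← Finset.mul_sum, sum_tupleChar_mul]
  split_ifs <;> simp

theorem sum_signIdempotent : ∑ s : SignGroup k, signIdempotent s = 1 := by
  simp only [signIdempotent]
  rw [Finset.sum_comm, Finset.sum_eq_single 1]
  · rw [MonoidAlgebra.one_def]
    simp only [← MonoidAlgebra.ofCoeff_single, ← MonoidAlgebra.ofCoeff_sum]
    rw [← Finsupp.single_finsetSum, ← Finset.mul_sum, sum_tupleChar]
    simp
  · intro h _ hh
    simp only [← MonoidAlgebra.ofCoeff_single, ← MonoidAlgebra.ofCoeff_sum]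
    rw [← Finsupp.single_finsetSum, ← Finset.mul_sum, sum_tupleChar]
    simp [hh]
  · simp

/-- The inverse Fourier transform on the group of sign tuples. -/
noncomputable def signFourier (k : ℕ) :
    (SignGroup k → ℝ) →ₐ[ℝ] MonoidAlgebra ℝ (SignGroup k) :=
  AlgHom.ofLinearMap
    { toFun := fun f => ∑ s, f s • signIdempotent s
      map_add' := fun f g => by simp only [Pi.add_apply, add_smul, Finset.sum_add_distrib]
      map_smul' := fun r f => by
        simp only [Pi.smul_apply, smul_eq_mul, mul_smul, Finset.smul_sum, RingHom.id_apply] }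
    (by simp [sum_signIdempotent])
    (fun f g => by
      simp only [LinearMap.coe_mk, AddHom.coe_mk,
        Pi.mul_apply, Finset.sum_mul_sum, smul_mul_smul_comm,
        signIdempotent_mul, smul_ite, smul_zero, Finset.sum_ite_eq, Finset.mem_univ, if_true])

theorem signFourier_apply (f : SignGroup k → ℝ) :
    signFourier k f = ∑ s, f s • signIdempotent s := rfl

/-- The average of a function on the group of sign tuples. -/
noncomputable def signMean (k : ℕ) : (SignGroup k → ℝ) →ₗ[ℝ] ℝ where
  toFun f := ∑ s, (2 ^ k)⁻¹ * f s
  map_add' f g := by simp only [Pi.add_apply, mul_add, Finset.sum_add_distrib]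
  map_smul' r f := by
    simp only [Pi.smul_apply, smul_eq_mul, RingHom.id_apply, Finset.mul_sum, mul_left_comm]

theorem signMean_apply (f : SignGroup k → ℝ) : signMean k f = ∑ s, (2 ^ k)⁻¹ * f s := rfl

theorem sum_inv_two_pow : ∑ _s : SignGroup k, (2 ^ k : ℝ)⁻¹ = 1 := by
  simp

/-- Every minimal idempotent has trace 2^(-k), so the canonical trace becomes the uniform average;
this is why equal weights are used. -/
theorem groupTrace_signFourier (f : SignGroup k → ℝ) :
    (signFourier k f).coeff 1 = signMean k f := by
  have h : ∀ s : SignGroup k, (signIdempotent s).coeff 1 = (2 ^ k)⁻¹ := by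
    intro s
    rw [signIdempotent, MonoidAlgebra.coeff_sum, Finsupp.finsetSum_apply,
      Finset.sum_eq_single 1]
    · rw [MonoidAlgebra.coeff_single, Finsupp.single_eq_same, tupleChar_one, mul_one]
    · intro h _ hh
      rw [MonoidAlgebra.coeff_single, Finsupp.single_eq_of_ne hh.symm]
    · simp
  rw [signFourier_apply, MonoidAlgebra.coeff_sum, Finsupp.finsetSum_apply, signMean_apply]
  refine Finset.sum_congr rfl fun s _ => ?_
  rw [MonoidAlgebra.coeff_smul_apply, h, smul_eq_mul, mul_comm]

end Idempotents

/-! ### Freeness in the group algebra of a free product. -/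

section FreeProduct

variable {H : Type*} [Group H]

/-- The free product of two copies of a group. -/
abbrev FreeSquare (H : Type*) [Group H] : Type _ := Monoid.CoprodI fun _ : Bool => H

/-- Acting on the empty word, a product of letters reproduces its reduced word; a trivial product
would make that word empty. -/
theorem neWord_prod_ne_one {i j : Bool} (w : Monoid.CoprodI.NeWord (fun _ : Bool => H) i j) :
    w.prod ≠ 1 := by
  classical
  intro h
  have key : ∀ v : Monoid.CoprodI.Word fun _ : Bool => H,
      v.prod • (Monoid.CoprodI.Word.empty : Monoid.CoprodI.Word fun _ : Bool => H) = v := by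
    apply Monoid.CoprodI.Word.smul_induction
    · rw [Monoid.CoprodI.Word.prod_empty, one_smul]
    · intro i m v ih
      rw [Monoid.CoprodI.Word.prod_smul, mul_smul, ih]
  have h2 : w.toWord = Monoid.CoprodI.Word.empty := by
    rw [← key w.toWord]
    exact (congrArg (· • _) h).trans (one_smul _ _)
  exact w.toList_ne_nil (congrArg Monoid.CoprodI.Word.toList h2)

/-- The span of the nonempty reduced words from the family `i` to the family `j`. -/
noncomputable def wordSpan (H : Type*) [Group H] (i j : Bool) :
    Submodule ℝ (MonoidAlgebra ℝ (FreeSquare H)) :=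
  Submodule.span ℝ (Set.range fun w : Monoid.CoprodI.NeWord (fun _ : Bool => H) i j =>
    MonoidAlgebra.single w.prod 1)

theorem alternatingSpaces_wordSpan :
    AlternatingSpaces (groupTrace (FreeSquare H)) (wordSpan H) where
  functional_one := MonoidAlgebra.coeff_one_one (R := ℝ) (M := FreeSquare H)
  functional_eq_zero i j a ha := by
    induction ha using Submodule.span_induction with
    | mem a ha =>
      obtain ⟨w, rfl⟩ := ha
      exact Finsupp.single_eq_of_ne (neWord_prod_ne_one w).symm
    | zero => exact map_zero _
    | add a b _ _ h1 h2 => rw [map_add, h1, h2, add_zero]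
    | smul r a _ h => rw [map_smul, h, smul_zero]
  mul_mem_of_ne i j k l hjk a ha b hb := by
    have h := Submodule.mul_mem_mul ha hb
    rw [wordSpan, wordSpan, Submodule.span_mul_span] at h
    refine Submodule.span_mono ?_ h
    rintro _ ⟨_, ⟨w, rfl⟩, _, ⟨w', rfl⟩, rfl⟩
    refine ⟨w.append hjk w', ?_⟩
    simp [MonoidAlgebra.single_mul_single]

/-- The embedding of the group algebra of `H` as the factor `i` of that of the free product. -/
noncomputable def factorMap (H : Type*) [Group H] (i : Bool) :
    MonoidAlgebra ℝ H →ₐ[ℝ] MonoidAlgebra ℝ (FreeSquare H) :=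
  MonoidAlgebra.mapDomainAlgHom ℝ ℝ (Monoid.CoprodI.of (M := fun _ : Bool => H) (i := i))

theorem factorMap_single (i : Bool) (h : H) (r : ℝ) :
    factorMap H i (MonoidAlgebra.single h r) =
      MonoidAlgebra.single (Monoid.CoprodI.of (M := fun _ : Bool => H) (i := i) h) r :=
  MonoidAlgebra.mapDomain_single

theorem factorMap_mem_wordSpan (i : Bool) {a : MonoidAlgebra ℝ H} (ha : a.coeff 1 = 0) :
    factorMap H i a ∈ wordSpan H i i := by
  rw [← MonoidAlgebra.sum_coeff_single a, Finsupp.sum, map_sum]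
  refine Submodule.sum_mem _ fun h hh => ?_
  have h1 : h ≠ 1 := by
    rintro rfl
    exact Finsupp.mem_support_iff.1 hh ha
  rw [factorMap_single, ← mul_one (a.coeff h), ← smul_eq_mul, ← MonoidAlgebra.smul_single]
  exact Submodule.smul_mem _ _ (Submodule.subset_span ⟨.singleton h h1, by simp⟩)

/-- This makes every element coming from a factor act self-adjointly, which is why a group of
exponent 2 is chosen. -/
theorem factorMap_mem_involutionSpan (hH : ∀ h : H, h * h = 1) (i : Bool) (a : MonoidAlgebra ℝ H) :
    factorMap H i a ∈ involutionSpan (FreeSquare H) := by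
  rw [← MonoidAlgebra.sum_coeff_single a, Finsupp.sum, map_sum]
  refine Submodule.sum_mem _ fun h _ => ?_
  rw [factorMap_single, ← mul_one (a.coeff h), ← smul_eq_mul, ← MonoidAlgebra.smul_single]
  refine Submodule.smul_mem _ _ (Submodule.subset_span ⟨_, ?_, rfl⟩)
  rw [← map_mul, hH, map_one]

end FreeProduct

/-! ### Existence of free convolutions. -/

section EqualWeights

/-- The measure with equal masses at the points `a s`. -/
noncomputable def uniformProb {k : ℕ} (a : SignGroup k → ℝ) : CompactProb :=
  discreteProb (fun _ => (2 ^ k)⁻¹) a (fun _ => by positivity) sum_inv_two_pow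

theorem moment_uniformProb {k : ℕ} (a : SignGroup k → ℝ) (n : ℕ) :
    moment (uniformProb a) n = signMean k (a ^ n) :=
  moment_discreteProb _ _ n

/-- The last equation is S(zv) = z with a factor z cancelled, the form needed by the resolvent
argument. -/
theorem exists_inverseMomentSeries_eq_X_mul (m : CompactProb) :
    ∃ v : ℝ⟦X⟧, inverseMomentSeries m = PowerSeries.X * v ∧ v.constantCoeff = 1 ∧
      v * (PowerSeries.mk (moment m)).subst (PowerSeries.X * v) = 1 := by
  obtain ⟨v, hv⟩ := PowerSeries.X_dvd_iff.2 (constantCoeff_inverseMomentSeries m)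
  have hs : PowerSeries.HasSubst (inverseMomentSeries m) :=
    .of_constantCoeff_zero' (constantCoeff_inverseMomentSeries m)
  have h1 : v * (PowerSeries.mk (moment m)).subst (PowerSeries.X * v) = 1 := by
    have h := momentSeries_subst_inverse m
    rw [momentSeries, PowerSeries.subst_mul hs, PowerSeries.subst_X hs, hv, mul_assoc] at h
    exact mul_left_cancel₀ PowerSeries.X_ne_zero (h.trans (mul_one _).symm)
  refine ⟨v, hv, ?_, h1⟩
  have h2 := coeff_one_momentSeries m
  have h4 := inverse_subst_momentSeries m
  have h5 := congrArg (PowerSeries.coeff 1) h4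
  rw [coeff_subst_eq_sum (constantCoeff_momentSeries m)] at h5
  rw [hv] at h5
  simpa [Finset.sum_range_succ, h2, PowerSeries.coeff_one] using h5

/-- Free convolutions of measures with equal masses exist. -/
theorem exists_isFreeConvolution_uniformProb {k : ℕ} (a b : SignGroup k → ℝ) {C D : ℝ}
    (ha : ∀ s, |a s| ≤ C) (hb : ∀ s, |b s| ≤ D) :
    ∃ τ : CompactProb, (∀ᵐ t ∂τ.1, |t| ≤ C + D) ∧
      IsFreeConvolution (uniformProb a) (uniformProb b) τ := by
  let j : ∀ _ : Bool, (SignGroup k → ℝ) →ₐ[ℝ] MonoidAlgebra ℝ (FreeSquare (SignGroup k)) :=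
    fun i => (factorMap (SignGroup k) i).comp (signFourier k)
  have hmem : ∀ i f, j i f ∈ involutionSpan (FreeSquare (SignGroup k)) := fun i f =>
    factorMap_mem_involutionSpan SignGroup.mul_self i _
  have hbound : ∀ i (f : SignGroup k → ℝ) (C : ℝ), (∀ s, |f s| ≤ C) →
      ∀ z, groupInner (j i f * z) (j i f * z) ≤ C ^ 2 * groupInner z z := by
    intro i f C hf z
    -- The complementary square root √(C² - f²) is taken pointwise on the 2^k points and then
    -- transported to the group algebra.
    refine groupInner_mul_le_of_sq (y := j i fun s => √(C ^ 2 - f s ^ 2)) (hmem _ _) (hmem _ _) ?_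
    rw [← map_mul, ← map_mul, ← map_add, ← map_one (j i), ← map_smul]
    congr 1
    ext s
    have : 0 ≤ C ^ 2 - f s ^ 2 := by
      have := sq_le_sq' (abs_le.1 (hf s)).1 (abs_le.1 (hf s)).2
      linarith
    have h := Real.mul_self_sqrt this
    simp only [Pi.add_apply, Pi.mul_apply, Pi.smul_apply, Pi.one_apply, smul_eq_mul, h]
    ring
  have hC : 0 ≤ C := (abs_nonneg _).trans (ha 1)
  have hD : 0 ≤ D := (abs_nonneg _).trans (hb 1)
  obtain ⟨τ, h1, h2⟩ := exists_compactProb_groupTrace (x := j true a + j false b)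
    (add_mem (hmem _ _) (hmem _ _)) (add_nonneg hC hD)
    (groupInner_add_mul_le hC hD (hbound _ _ _ ha) (hbound _ _ _ hb))
  refine ⟨τ, h1, ?_⟩
  obtain ⟨v₁, e1, c1, m1⟩ := exists_inverseMomentSeries_eq_X_mul (uniformProb a)
  obtain ⟨v₂, e2, c2, m2⟩ := exists_inverseMomentSeries_eq_X_mul (uniformProb b)
  have key := alternatingSpaces_wordSpan.subst_add_eq_one (fun _ => signMean k) j
    (fun i f hf => factorMap_mem_wordSpan i ((groupTrace_signFourier f).trans hf))
    (fun _ => by rw [signMean_apply]; simp)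
    (fun i => if i then a else b) (v := fun i => if i then v₁ else v₂)
    (by rintro (_ | _) <;> assumption)
    (by
      rintro (_ | _)
      · simp only [← moment_uniformProb, Bool.false_eq_true, if_false]
        exact m2
      · simp only [← moment_uniformProb, if_true]
        exact m1)
  simp only [if_true, Bool.false_eq_true, if_false, ← h2] at key
  set w : ℝ⟦X⟧ := v₁⁻¹ + v₂⁻¹ - 1 with hw
  have hs : PowerSeries.HasSubst (PowerSeries.X * w⁻¹ : ℝ⟦X⟧) :=
    .of_constantCoeff_zero' (constantCoeff_X_mul _)
  have hτ : PowerSeries.X * w⁻¹ = inverseMomentSeries τ := by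
    apply eq_inverseMomentSeries' (constantCoeff_X_mul _)
    rw [momentSeries, PowerSeries.subst_mul hs, PowerSeries.subst_X hs, mul_assoc]
    change PowerSeries.X * (w⁻¹ * (PowerSeries.mk fun k => moment τ k).subst _) = _
    rw [key, mul_one]
  rw [isFreeConvolution_iff, SumInvEq, e1, e2, ← hτ]
  have i1 : v₁⁻¹ * v₁ = 1 := PowerSeries.inv_mul_cancel _ (by simp [c1])
  have i2 : v₂⁻¹ * v₂ = 1 := PowerSeries.inv_mul_cancel _ (by simp [c2])
  have iw : w⁻¹ * w = 1 := PowerSeries.inv_mul_cancel _ (by simp [hw, c1, c2])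
  have h3 : v₁ + v₂ = v₁ * v₂ * (1 + w) := by
    rw [hw]
    linear_combination (-v₂) * i1 - v₁ * i2
  rw [show (PowerSeries.X * v₁ + PowerSeries.X * v₂ : ℝ⟦X⟧) = PowerSeries.X * (v₁ + v₂) by ring, h3]
  linear_combination (PowerSeries.X ^ 3 * v₁ * v₂) * iw

/-- Free convolutions of compactly supported probability measures exist. -/
theorem exists_isFreeConvolution (μ ν : CompactProb) : ∃ τ, IsFreeConvolution μ ν τ := by
  obtain ⟨C, hC⟩ := hasCompactSupp_iff.1 μ.2.2
  obtain ⟨D, hD⟩ := hasCompactSupp_iff.1 ν.2.2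
  have approx : ∀ (m : CompactProb) (C : ℝ), (∀ᵐ x ∂m.1, |x| ≤ C) →
      ∃ a : ∀ k : ℕ, SignGroup k → ℝ, (∀ k s, |a k s| ≤ C) ∧
        ∀ n, Tendsto (fun k => moment (uniformProb (a k)) n) atTop (𝓝 (moment m n)) := by
    intro m C hm
    obtain ⟨x, hx, hlim⟩ := exists_tendsto_empirical_moment m hm
    have hcard : ∀ k, Fintype.card (SignGroup k) = 2 ^ k := by simp
    let e : ∀ k, SignGroup k ≃ Fin (2 ^ k) := fun k => Fintype.equivFinOfCardEq (hcard k)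
    refine ⟨fun k s => x (e k s), fun k s => hx _, fun n => ?_⟩
    -- The group has 2^k elements, so only the empirical averages of length 2^k are used.
    refine ((hlim n).comp (tendsto_pow_atTop_atTop_of_one_lt one_lt_two)).congr fun k => ?_
    rw [moment_uniformProb, signMean_apply, ← Finset.mul_sum]
    simp only [Pi.pow_apply, Function.comp_apply]
    rw [(e k).sum_comp fun i : Fin (2 ^ k) => x i ^ n, Finset.sum_range, div_eq_inv_mul]
    push_cast
    rfl
  obtain ⟨a, ha, hal⟩ := approx μ C hC
  obtain ⟨b, hb, hbl⟩ := approx ν D hD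
  choose τ h1 h2 using fun k => exists_isFreeConvolution_uniformProb (a k) (b k) (ha k) (hb k)
  obtain ⟨φ, τ', hφ, -, h3, -⟩ := exists_subseq_tendsto_moment h1
  exact ⟨τ', IsFreeConvolution.of_tendsto (fun j => h2 (φ j))
    (fun n => (hal n).comp hφ.tendsto_atTop) (fun n => (hbl n).comp hφ.tendsto_atTop) h3⟩

end EqualWeights

/-! ### Exponentials and logarithms of formal power series. -/

section ExpSeries

/-- The quotient F/G has derivative zero and constant term 1. -/
theorem eq_of_derivative_eq_mul {F G h : ℝ⟦X⟧} (hF : PowerSeries.derivative ℝ F = h * F)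
    (hG : PowerSeries.derivative ℝ G = h * G) (hF0 : F.constantCoeff = 1)
    (hG0 : G.constantCoeff = 1) : F = G := by
  have hi : G⁻¹ * G = 1 := PowerSeries.inv_mul_cancel _ (by simp [hG0])
  have h1 : F * G⁻¹ = 1 := by
    apply PowerSeries.derivative.ext
    · rw [Derivation.leibniz, PowerSeries.derivative_inv', hF, hG, smul_eq_mul, smul_eq_mul,
        Derivation.map_one_eq_zero]
      linear_combination (-F * G⁻¹ * h) * hi
    · simp [hF0, hG0]
  calc F = F * G⁻¹ * G := by rw [mul_assoc, hi, mul_one]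
    _ = G := by rw [h1, one_mul]

theorem constantCoeff_exp_subst {f : ℝ⟦X⟧} (hf : f.constantCoeff = 0) :
    PowerSeries.constantCoeff ((PowerSeries.exp ℝ).subst f : ℝ⟦X⟧) = 1 := by
  rw [← PowerSeries.coeff_zero_eq_constantCoeff_apply, coeff_subst_eq_sum hf]
  simp

theorem derivative_exp_subst {f : ℝ⟦X⟧} (hf : f.constantCoeff = 0) :
    PowerSeries.derivative ℝ ((PowerSeries.exp ℝ).subst f)
      = PowerSeries.derivative ℝ f * (PowerSeries.exp ℝ).subst f := by
  rw [PowerSeries.derivative_subst (.of_constantCoeff_zero' hf), PowerSeries.derivative_exp,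
    mul_comm]

theorem exp_subst_add {f g : ℝ⟦X⟧} (hf : f.constantCoeff = 0) (hg : g.constantCoeff = 0) :
    ((PowerSeries.exp ℝ).subst (f + g) : ℝ⟦X⟧)
      = (PowerSeries.exp ℝ).subst f * (PowerSeries.exp ℝ).subst g := by
  have hfg : (f + g).constantCoeff = 0 := by simp [hf, hg]
  refine eq_of_derivative_eq_mul (derivative_exp_subst hfg) ?_ (constantCoeff_exp_subst hfg) ?_
  · rw [Derivation.leibniz, derivative_exp_subst hf, derivative_exp_subst hg, map_add, smul_eq_mul,
      smul_eq_mul]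
    ring
  · rw [map_mul, constantCoeff_exp_subst hf, constantCoeff_exp_subst hg, one_mul]

theorem exp_subst_sum {ι : Type*} (s : Finset ι) {f : ι → ℝ⟦X⟧}
    (hf : ∀ i, (f i).constantCoeff = 0) :
    ((PowerSeries.exp ℝ).subst (∑ i ∈ s, f i) : ℝ⟦X⟧)
      = ∏ i ∈ s, (PowerSeries.exp ℝ).subst (f i) := by
  classical
  induction s using Finset.induction_on with
  | empty =>
    rw [Finset.sum_empty, Finset.prod_empty]
    ext n
    rw [coeff_subst_eq_sum (by simp), Finset.sum_range_succ']
    simp [PowerSeries.coeff_one]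
  | insert i s hi ih =>
    rw [Finset.sum_insert hi, Finset.prod_insert hi, exp_subst_add (hf i) (by simp [hf]), ih]

/-- The power series of `-log (1 - a z)`. -/
noncomputable def negLogSeries (a : ℝ) : ℝ⟦X⟧ :=
  PowerSeries.X * PowerSeries.mk fun k => a ^ (k + 1) / (k + 1)

theorem constantCoeff_negLogSeries (a : ℝ) : (negLogSeries a).constantCoeff = 0 := by
  simp [negLogSeries]

theorem one_sub_mul_mk_pow (a : ℝ) :
    (1 - PowerSeries.C a * PowerSeries.X) * PowerSeries.mk (fun k => a ^ k) = 1 := by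
  ext n
  rw [sub_mul, one_mul, map_sub, mul_assoc, PowerSeries.coeff_C_mul]
  cases n with
  | zero => simp
  | succ n =>
    rw [PowerSeries.coeff_succ_X_mul]
    simp [PowerSeries.coeff_one, pow_succ']

theorem derivative_negLogSeries (a : ℝ) :
    PowerSeries.derivative ℝ (negLogSeries a) = PowerSeries.C a *
      PowerSeries.mk fun k => a ^ k := by
  ext n
  rw [PowerSeries.coeff_derivative, negLogSeries, PowerSeries.coeff_succ_X_mul,
    PowerSeries.coeff_C_mul, PowerSeries.coeff_mk, PowerSeries.coeff_mk]
  field_simp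
  ring

theorem exp_subst_neg_negLogSeries (a : ℝ) :
    ((PowerSeries.exp ℝ).subst (-negLogSeries a) : ℝ⟦X⟧)
      = 1 - PowerSeries.C a * PowerSeries.X := by
  have h0 : (-negLogSeries a).constantCoeff = 0 := by simp [constantCoeff_negLogSeries]
  refine eq_of_derivative_eq_mul (derivative_exp_subst h0) ?_ (constantCoeff_exp_subst h0) (by simp)
  rw [map_neg, derivative_negLogSeries, map_sub, Derivation.map_one_eq_zero, Derivation.leibniz,
    PowerSeries.derivative_X, PowerSeries.derivative_C]
  simp only [smul_eq_mul, mul_one, mul_zero, add_zero, zero_sub]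
  linear_combination PowerSeries.C a * one_sub_mul_mk_pow a

end ExpSeries

/-! ### Partial fractions with interlacing zeros and poles. -/

section PartialFractions

open Polynomial

variable {ι : Type*} [Fintype ι] [DecidableEq ι]

/-- The partial fraction decomposition
`∏ (t - x i) / (t - y i) = 1 - ∑ w i / (t - y i)` with the denominators cleared. -/
def IsPartialFraction (x y w : ι → ℝ) : Prop :=
  ∏ i, (X - C (x i)) = ∏ i, (X - C (y i)) - ∑ i, C (w i) * ∏ k ∈ Finset.univ.erase i, (X - C (y k))

/-- Put t = 1/z and multiply by z to the number of factors. The products with one factor erased are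
one degree short, which leaves the extra X. -/
theorem IsPartialFraction.reverse {x y w : ι → ℝ} (h : IsPartialFraction x y w) :
    ∏ i, (1 - C (x i) * X) = ∏ i, (1 - C (y i) * X)
      - X * ∑ i, C (w i) * ∏ k ∈ Finset.univ.erase i, (1 - C (y k) * X) := by
  refine Polynomial.eq_of_infinite_eval_eq _ _
    (Set.Infinite.mono (s := {z | z ≠ 0}) (fun z hz => ?_)
      (Set.finite_singleton (0 : ℝ)).infinite_compl)
  replace hz : z ≠ 0 := hz
  have key : ∀ (s : Finset ι) (u : ι → ℝ),
      ∏ i ∈ s, (1 - u i * z) = z ^ s.card * ∏ i ∈ s, (z⁻¹ - u i) := by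
    intro s u
    rw [← Finset.prod_const, ← Finset.prod_mul_distrib]
    refine Finset.prod_congr rfl fun i _ => ?_
    field_simp
  have h1 := congrArg (Polynomial.eval z⁻¹) h
  simp only [eval_sub, eval_prod, eval_X, eval_C, eval_finsetSum, eval_mul] at h1
  change Polynomial.eval z _ = Polynomial.eval z _
  simp only [eval_sub, eval_prod, eval_X, eval_C, eval_finsetSum, eval_mul, eval_one, key, h1,
    mul_sub, Finset.mul_sum]
  congr 1
  refine Finset.sum_congr rfl fun i _ => ?_
  have hc : (Finset.univ : Finset ι).card = (Finset.univ.erase i).card + 1 :=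
    (Finset.card_erase_add_one (Finset.mem_univ i)).symm
  rw [hc, pow_succ]
  ring

/-- Expanding 1 / (1 - y_i z) geometrically turns the residues into the moments ∑ w_i y_i^k. -/
theorem IsPartialFraction.powerSeries {x y w : ι → ℝ} (h : IsPartialFraction x y w) :
    ∏ i, (1 - PowerSeries.C (x i) * PowerSeries.X) =
      (∏ i, (1 - PowerSeries.C (y i) * PowerSeries.X)) *
        (1 - PowerSeries.X * PowerSeries.mk fun k => ∑ i, w i * y i ^ k) := by
  have h1 := congrArg (Polynomial.coeToPowerSeries.ringHom (R := ℝ)) h.reverse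
  simp only [map_prod, map_sub, map_mul, map_sum, map_one,
    Polynomial.coeToPowerSeries.ringHom_apply, Polynomial.coe_C, Polynomial.coe_X] at h1
  rw [h1]
  have h2 : (PowerSeries.mk fun k => ∑ i, w i * y i ^ k : ℝ⟦X⟧)
      = ∑ i, PowerSeries.C (w i) * (PowerSeries.mk fun k => y i ^ k : ℝ⟦X⟧) := by
    ext n
    simp [PowerSeries.coeff_C_mul]
  rw [mul_sub, mul_one, mul_left_comm, h2,
    Finset.mul_sum _ _ (∏ i, (1 - PowerSeries.C (y i) * PowerSeries.X))]
  refine congrArg₂ (· - ·) rfl (congrArg (PowerSeries.X * ·) (Finset.sum_congr rfl fun i _ => ?_))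
  rw [← Finset.mul_prod_erase _ _ (Finset.mem_univ i)]
  linear_combination (-PowerSeries.C (w i) *
    ∏ k ∈ Finset.univ.erase i, (1 - PowerSeries.C (y k) * PowerSeries.X)) * one_sub_mul_mk_pow (y i)

/-- The exponent is the sum of log(1 - x_i z) minus that of log(1 - y_i z); its coefficients are, up
to sign, the integrals of t^k over the intervals from y_i to x_i. -/
theorem IsPartialFraction.exp_subst {x y w : ι → ℝ} (h : IsPartialFraction x y w) :
    ((PowerSeries.exp ℝ).subst (-(PowerSeries.X * PowerSeries.mk fun k : ℕ =>
        ∑ i, (x i ^ (k + 1) - y i ^ (k + 1)) / (k + 1)) : ℝ⟦X⟧) : ℝ⟦X⟧)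
      = 1 - PowerSeries.X * PowerSeries.mk fun k => ∑ i, w i * y i ^ k := by
  have hL : (PowerSeries.X * PowerSeries.mk fun k : ℕ =>
        ∑ i, (x i ^ (k + 1) - y i ^ (k + 1)) / (k + 1) : ℝ⟦X⟧)
      = ∑ i, negLogSeries (x i) - ∑ i, negLogSeries (y i) := by
    simp only [negLogSeries, ← Finset.mul_sum, ← mul_sub]
    congr 1
    ext n
    simp [sub_div]
  have hx : ∀ i, (-negLogSeries (x i)).constantCoeff = 0 := by simp [constantCoeff_negLogSeries]
  have hy : ∀ i, (-negLogSeries (y i)).constantCoeff = 0 := by simp [constantCoeff_negLogSeries]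
  have h1 := exp_subst_sum Finset.univ hx
  have h2 := exp_subst_sum Finset.univ hy
  simp only [exp_subst_neg_negLogSeries] at h1 h2
  have h3 : ((PowerSeries.exp ℝ).subst (∑ i, -negLogSeries (x i)) : ℝ⟦X⟧)
      = (PowerSeries.exp ℝ).subst (∑ i, -negLogSeries (y i)) *
        (PowerSeries.exp ℝ).subst (-(∑ i, negLogSeries (x i) - ∑ i, negLogSeries (y i))) := by
    rw [← exp_subst_add (by simp [constantCoeff_negLogSeries])
      (by simp [constantCoeff_negLogSeries])]
    congr 1
    simp only [Finset.sum_neg_distrib]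
    ring
  rw [h1, h2, h.powerSeries] at h3
  rw [hL]
  refine (mul_left_cancel₀ ?_ h3).symm
  rw [Finset.prod_ne_zero_iff]
  intro i _ h0
  have := congrArg PowerSeries.constantCoeff h0
  simp at this

/-- Comparing coefficients of z equates total length with total mass, so the two measures are
normalized together. -/
theorem IsPartialFraction.sum_eq {x y w : ι → ℝ} (h : IsPartialFraction x y w) :
    ∑ i, (x i - y i) = ∑ i, w i := by
  have h1 := congrArg (PowerSeries.coeff 1) h.exp_subst
  rw [coeff_subst_eq_sum (by simp)] at h1
  have h2 : ∀ f : ℝ⟦X⟧, (PowerSeries.X * f).coeff 1 = f.constantCoeff := fun f => by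
    simp
  simp [Finset.sum_range_succ, PowerSeries.coeff_one, PowerSeries.coeff_exp, h2] at h1
  rw [Finset.sum_sub_distrib]
  linarith

/-- The monic leading terms cancel, so agreement at as many distinct points as there are indices
proves the decomposition. -/
theorem degree_prod_sub_sum_sub_prod_lt [Nonempty ι] (x y w : ι → ℝ) :
    (∏ i, (X - C (y i)) - ∑ i, C (w i) * ∏ k ∈ Finset.univ.erase i, (X - C (y k))
      - ∏ i, (X - C (x i))).degree < Fintype.card ι := by
  have hdeg : ∀ (s : Finset ι) (u : ι → ℝ), (∏ i ∈ s, (X - C (u i))).degree =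
      (s.card : WithBot ℕ) := by
    intro s u
    simp [degree_prod]
  rw [sub_right_comm]
  refine (degree_sub_le _ _).trans_lt (max_lt ?_ ?_)
  · have h1 : (∏ i, (X - C (y i))).Monic := monic_prod_of_monic _ _ fun i _ => monic_X_sub_C _
    have h2 : (∏ i, (X - C (x i))).Monic := monic_prod_of_monic _ _ fun i _ => monic_X_sub_C _
    have h3 := degree_sub_lt_left ((hdeg Finset.univ y).trans (hdeg Finset.univ x).symm) h1.ne_zero
      (h1.leadingCoeff.trans h2.leadingCoeff.symm)
    rwa [hdeg Finset.univ y, Finset.card_univ] at h3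
  · refine (degree_sum_le _ _).trans_lt ?_
    rw [Finset.sup_lt_iff (by exact WithBot.bot_lt_coe _)]
    intro i _
    refine (degree_mul_le _ _).trans_lt ((add_le_add degree_C_le le_rfl).trans_lt ?_)
    rw [zero_add, hdeg, Finset.card_erase_of_mem (Finset.mem_univ i), Finset.card_univ]
    exact_mod_cast Nat.sub_lt (Fintype.card_pos (α := ι)) one_pos


theorem eval_prod_sub_sum (y w : ι → ℝ) (i : ι) :
    (∏ i, (X - C (y i)) - ∑ i, C (w i) * ∏ k ∈ Finset.univ.erase i, (X - C (y k))).eval (y i)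
      = -(w i * ∏ k ∈ Finset.univ.erase i, (y i - y k)) := by
  have h0 : ∏ k, (y i - y k) = 0 := Finset.prod_eq_zero (Finset.mem_univ i) (sub_self _)
  simp only [eval_sub, eval_prod, eval_X, eval_C, eval_finsetSum, eval_mul, h0, zero_sub]
  rw [Finset.sum_eq_single i]
  · intro j _ hj
    rw [Finset.prod_eq_zero (Finset.mem_erase.2 ⟨hj.symm, Finset.mem_univ i⟩)
      (sub_self _), mul_zero]
  · simp

/-- Interlacing zeros and poles have nonnegative residues. -/
theorem exists_isPartialFraction_of_interlacing {ι : Type*} [Fintype ι] [Nonempty ι] [LinearOrder ι]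
    {x y : ι → ℝ} (hy : StrictMono y) (hyx : ∀ i, y i ≤ x i) (hxy : ∀ i j, i < j → x i ≤ y j) :
    ∃ w : ι → ℝ, (∀ i, 0 ≤ w i) ∧ IsPartialFraction x y w := by
  -- The residues, read off by evaluating at y i. Interlacing gives numerator and denominator of
  -- each factor the same sign.
  let w : ι → ℝ := fun i =>
    (x i - y i) * ∏ k ∈ Finset.univ.erase i, ((y i - x k) / (y i - y k))
  refine ⟨w, fun i => ?_, ?_⟩
  · refine mul_nonneg (sub_nonneg.2 (hyx i)) (Finset.prod_nonneg fun k hk => ?_)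
    rcases lt_or_gt_of_ne (Finset.ne_of_mem_erase hk) with h | h
    · exact div_nonneg (sub_nonneg.2 (hxy k i h)) (sub_nonneg.2 (hy h).le)
    · exact div_nonneg_of_nonpos (sub_nonpos.2 ((hy h).le.trans (hyx k))) (sub_nonpos.2 (hy h).le)
  · rw [IsPartialFraction]
    symm
    refine eq_of_degree_sub_lt_of_eval_index_eq Finset.univ hy.injective.injOn
      (degree_prod_sub_sum_sub_prod_lt x y w) fun i _ => ?_
    rw [eval_prod_sub_sum, eval_prod, ← Finset.mul_prod_erase _ _ (Finset.mem_univ i)]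
    simp only [eval_sub, eval_X, eval_C, w]
    rw [mul_assoc, ← Finset.prod_mul_distrib]
    rw [Finset.prod_congr rfl fun k hk => div_mul_cancel₀ (y i - x k)
      (sub_ne_zero.2 (hy.injective.ne (Finset.ne_of_mem_erase hk).symm))]
    ring

/-- Positive residues give zeros that interlace with the poles. -/
theorem exists_interlacing_isPartialFraction {n : ℕ} {y w : Fin (n + 1) → ℝ} (hy : StrictMono y)
    (hw : ∀ i, 0 < w i) :
    ∃ x : Fin (n + 1) → ℝ, (∀ i, y i ≤ x i) ∧ (∀ i j, i < j → x i ≤ y j) ∧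
      (∀ i, x i ≤ y (Fin.last n) + ∑ i, w i) ∧ IsPartialFraction x y w := by
  set P : ℝ[X] :=
    ∏ i, (X - C (y i)) - ∑ i, C (w i) * ∏ k ∈ Finset.univ.erase i, (X - C (y k)) with hP
  have hW : 0 < ∑ i, w i := Finset.sum_pos (fun i _ => hw i) Finset.univ_nonempty
  have hroot : ∀ i : Fin n, ∃ t, y i.castSucc < t ∧ t < y i.succ ∧ P.eval t = 0 := by
    intro i
    have hlt : i.castSucc < i.succ := Fin.castSucc_lt_succ
    have hsign : P.eval (y i.castSucc) * P.eval (y i.succ) < 0 := by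
      rw [hP, eval_prod_sub_sum, eval_prod_sub_sum,
        ← Finset.mul_prod_erase (Finset.univ.erase i.castSucc) _
          (Finset.mem_erase.2 ⟨hlt.ne', Finset.mem_univ i.succ⟩),
        ← Finset.mul_prod_erase (Finset.univ.erase i.succ) _
          (Finset.mem_erase.2 ⟨hlt.ne, Finset.mem_univ i.castSucc⟩),
        Finset.erase_right_comm]
      -- Every other pole lies on the same side of these two neighbours, so only the factors y_i -
      -- y_(i+1) and y_(i+1) - y_i contribute opposite signs.
      have hpos : 0 < (∏ k ∈ (Finset.univ.erase i.succ).erase i.castSucc, (y i.castSucc - y k)) *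
          ∏ k ∈ (Finset.univ.erase i.succ).erase i.castSucc, (y i.succ - y k) := by
        rw [← Finset.prod_mul_distrib]
        refine Finset.prod_pos fun k hk => ?_
        have h1 := Finset.ne_of_mem_erase hk
        have h2 := Finset.ne_of_mem_erase (Finset.mem_of_mem_erase hk)
        rcases lt_or_gt_of_ne h1 with h | h
        · exact mul_pos (sub_pos.2 (hy h)) (sub_pos.2 (hy (h.trans hlt)))
        · have h3 : i.succ < k := lt_of_le_of_ne (Fin.castSucc_lt_iff_succ_le.1 h) h2.symm
          exact mul_pos_of_neg_of_neg (sub_neg.2 (hy h)) (sub_neg.2 (hy h3))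
      have h4 := sub_pos.2 (hy hlt)
      have h5 := mul_pos (mul_pos (hw i.castSucc) (hw i.succ)) (mul_pos (mul_pos h4 h4) hpos)
      linarith [h5]
    have hc : ContinuousOn (fun t => P.eval t) (Set.Icc (y i.castSucc) (y i.succ)) :=
      P.continuous.continuousOn
    have hmem : (0 : ℝ) ∈ (fun t => P.eval t) '' Set.Ioo (y i.castSucc) (y i.succ) := by
      rcases mul_neg_iff.1 hsign with h | h
      · exact intermediate_value_Ioo' (hy hlt).le hc ⟨h.2, h.1⟩
      · exact intermediate_value_Ioo (hy hlt).le hc ⟨h.1, h.2⟩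
    obtain ⟨t, ht, h0⟩ := hmem
    exact ⟨t, ht.1, ht.2, h0⟩
  have hlast : ∃ t, y (Fin.last n) < t ∧ t ≤ y (Fin.last n) + ∑ i, w i ∧ P.eval t = 0 := by
    have hneg : P.eval (y (Fin.last n)) < 0 := by
      rw [hP, eval_prod_sub_sum, neg_lt_zero]
      refine mul_pos (hw _) (Finset.prod_pos fun k hk => sub_pos.2 (hy ?_))
      exact lt_of_le_of_ne (Fin.le_last k) (Finset.ne_of_mem_erase hk)
    have hpos : 0 ≤ P.eval (y (Fin.last n) + ∑ i, w i) := by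
      rw [hP]
      simp only [eval_sub, eval_prod, eval_X, eval_C, eval_finsetSum, eval_mul]
      -- At this point t - y_i ≥ ∑ w for every i, hence ∑ w_i / (t - y_i) ≤ 1 and P is nonnegative.
      -- This bounds the last zero.
      set t := y (Fin.last n) + ∑ i, w i with ht
      have hge : ∀ i, ∑ i, w i ≤ t - y i := fun i => by
        have := hy.monotone (Fin.le_last i)
        linarith
      have hle : ∀ i, (∑ i, w i) * (w i * ∏ k ∈ Finset.univ.erase i, (t - y k))
          ≤ w i * ∏ k, (t - y k) := by
        intro i
        rw [← Finset.mul_prod_erase _ _ (Finset.mem_univ i), mul_left_comm]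
        refine mul_le_mul_of_nonneg_left (mul_le_mul_of_nonneg_right (hge i) ?_) (hw i).le
        exact Finset.prod_nonneg fun k _ => hW.le.trans (hge k)
      have hsum := Finset.sum_le_sum fun i (_ : i ∈ Finset.univ) => hle i
      rw [← Finset.mul_sum, ← Finset.sum_mul] at hsum
      exact sub_nonneg.2 (le_of_mul_le_mul_left hsum hW)
    obtain ⟨t, ht, h0⟩ := intermediate_value_Ioc (by linarith) P.continuous.continuousOn
      ⟨hneg, hpos⟩
    exact ⟨t, ht.1, ht.2, h0⟩
  choose r hr1 hr2 hr3 using hroot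
  obtain ⟨t, ht1, ht2, ht3⟩ := hlast
  let x : Fin (n + 1) → ℝ := Fin.snoc r t
  have hx1 : ∀ i, y i < x i := by
    intro i
    cases i using Fin.lastCases with
    | last => simpa [x] using ht1
    | cast i => simpa [x] using hr1 i
  have hx2 : ∀ i j, i < j → x i ≤ y j := by
    intro i j hij
    cases i using Fin.lastCases with
    | last => exact absurd (Fin.le_last j) hij.not_ge
    | cast i =>
      have h := hy.monotone (Fin.castSucc_lt_iff_succ_le.1 hij)
      simpa [x] using (hr2 i).le.trans h
  have hx3 : ∀ i, P.eval (x i) = 0 := by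
    intro i
    cases i using Fin.lastCases with
    | last => simpa [x] using ht3
    | cast i => simpa [x] using hr3 i
  have hmono : StrictMono x := fun i j hij => (hx2 i j hij).trans_lt (hx1 j)
  refine ⟨x, fun i => (hx1 i).le, hx2, fun i => ?_, ?_⟩
  · exact (hmono.monotone (Fin.le_last i)).trans (by simpa [x] using ht2)
  · rw [IsPartialFraction]
    symm
    refine eq_of_degree_sub_lt_of_eval_index_eq Finset.univ hmono.injective.injOn
      (degree_prod_sub_sum_sub_prod_lt x y w) fun i _ => ?_
    rw [← hP, hx3, eval_prod]
    exact (Finset.prod_eq_zero (Finset.mem_univ i) (by simp)).symm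

end PartialFractions

/-! ### Lebesgue measure on unions of intervals. -/

section IntervalMeasures

/-- Half-open intervals stay disjoint when neighbours share an endpoint, as full grid cells do. -/
theorem pairwise_disjoint_Ico {ι : Type*} [LinearOrder ι] {x y : ι → ℝ}
    (hxy : ∀ i j, i < j → x i ≤ y j) :
    Pairwise fun i j => Disjoint (Set.Ico (y i) (x i)) (Set.Ico (y j) (x j)) := by
  have h : ∀ i j, i < j → Disjoint (Set.Ico (y i) (x i)) (Set.Ico (y j) (x j)) := by
    intro i j hij
    rw [Set.disjoint_left]
    intro t ht ht'
    exact absurd ht.2 (not_lt.2 ((hxy i j hij).trans ht'.1))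
  intro i j hij
  rcases lt_or_gt_of_ne hij with h' | h'
  · exact h i j h'
  · exact (h j i h').symm

variable {ι : Type*} [Fintype ι] [LinearOrder ι] {x y w : ι → ℝ}

theorem setIntegral_iUnion_Ico (hxy : ∀ i j, i < j → x i ≤ y j) {f : ℝ → ℝ}
    (hf : ∀ i, IntegrableOn f (Set.Ico (y i) (x i))) :
    ∫ t in ⋃ i, Set.Ico (y i) (x i), f t = ∑ i, ∫ t in Set.Ico (y i) (x i), f t :=
  integral_iUnion_fintype (fun _ => measurableSet_Ico) (pairwise_disjoint_Ico hxy) hf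

theorem volume_iUnion_Ico (hyx : ∀ i, y i ≤ x i) (hxy : ∀ i j, i < j → x i ≤ y j) :
    volume (⋃ i, Set.Ico (y i) (x i)) = ENNReal.ofReal (∑ i, (x i - y i)) := by
  rw [measure_iUnion (pairwise_disjoint_Ico hxy) fun _ => measurableSet_Ico, tsum_fintype,
    ENNReal.ofReal_sum_of_nonneg fun i _ => sub_nonneg.2 (hyx i)]
  simp only [Real.volume_Ico]

theorem ae_restrict_iUnion_Ico_abs_le {C : ℝ} (hy : ∀ i, -C ≤ y i) (hx : ∀ i, x i ≤ C) :
    ∀ᵐ t ∂volume.restrict (⋃ i, Set.Ico (y i) (x i)), |t| ≤ C := by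
  filter_upwards [ae_restrict_mem (MeasurableSet.iUnion fun i => measurableSet_Ico)] with t ht
  obtain ⟨i, hi⟩ := Set.mem_iUnion.1 ht
  exact abs_le.2 ⟨(hy i).trans hi.1, hi.2.le.trans (hx i)⟩

/-- A partial fraction decomposition with interlacing zeros and poles relates a union of intervals
and a finitely supported measure. -/
theorem IsPartialFraction.exists_expMomentIdentity (h : IsPartialFraction x y w)
    (hyx : ∀ i, y i ≤ x i) (hxy : ∀ i j, i < j → x i ≤ y j) (hw : ∀ i, 0 ≤ w i)
    (h1 : ∑ i, w i = 1) :
    ∃ ρ : BoundedDensityProb, ρ.1 = volume.restrict (⋃ i, Set.Ico (y i) (x i)) ∧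
      ExpMomentIdentity ρ.toCompactProb (discreteProb w y hw h1) := by
  have hprob : IsProbabilityMeasure (volume.restrict (⋃ i, Set.Ico (y i) (x i))) := ⟨by
    rw [Measure.restrict_apply_univ, volume_iUnion_Ico hyx hxy, h.sum_eq, h1, ENNReal.ofReal_one]⟩
  have hsupp : HasCompactSupp (volume.restrict (⋃ i, Set.Ico (y i) (x i))) := by
    refine hasCompactSupp_iff.2 ⟨∑ i, (|x i| + |y i|), ae_restrict_iUnion_Ico_abs_le ?_ ?_⟩
    · intro i
      have := Finset.single_le_sum (f := fun i => |x i| + |y i|) (fun i _ => by positivity)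
        (Finset.mem_univ i)
      linarith [neg_abs_le (y i), abs_nonneg (x i)]
    · intro i
      have := Finset.single_le_sum (f := fun i => |x i| + |y i|) (fun i _ => by positivity)
        (Finset.mem_univ i)
      linarith [le_abs_self (x i), abs_nonneg (y i)]
  let ρ : BoundedDensityProb := ⟨volume.restrict (⋃ i, Set.Ico (y i) (x i)), hprob, hsupp,
    hasDensityAtMostOne_iff.2 Measure.restrict_le_self⟩
  refine ⟨ρ, rfl, ?_⟩
  have hρ : moment ρ.toCompactProb = fun k : ℕ =>
      ∑ i, (x i ^ (k + 1) - y i ^ (k + 1)) / (k + 1) := by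
    funext k
    change ∫ t in ⋃ i, Set.Ico (y i) (x i), t ^ k = _
    rw [setIntegral_iUnion_Ico hxy fun i =>
      (continuous_pow k).continuousOn.integrableOn_Icc.mono_set Set.Ico_subset_Icc_self]
    refine Finset.sum_congr rfl fun i _ => ?_
    rw [integral_Ico_eq_integral_Ioc, ← intervalIntegral.integral_of_le (hyx i), integral_pow]
  have hν : moment (discreteProb w y hw h1) = fun k : ℕ => ∑ i, w i * y i ^ k :=
    funext fun k => moment_discreteProb hw h1 k
  rw [ExpMomentIdentity, momentSeries, momentSeries, hρ, hν]
  exact h.exp_subst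

end IntervalMeasures

/-! ### Grid cells and their masses. -/

section Grid

/-- The grid cell with left endpoint `j / (n + 1)`. -/
def gridCell (n : ℕ) (j : ℤ) : Set ℝ := {x | ⌊(n + 1 : ℝ) * x⌋ = j}

theorem gridCell_eq_Ico (n : ℕ) (j : ℤ) :
    gridCell n j = Set.Ico ((j : ℝ) / (n + 1)) ((j : ℝ) / (n + 1) + 1 / (n + 1)) := by
  have hn : (0 : ℝ) < n + 1 := by positivity
  ext x
  rw [gridCell, Set.mem_ofPred_eq, Int.floor_eq_iff, Set.mem_Ico, div_le_iff₀ hn, ← add_div,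
    lt_div_iff₀ hn, mul_comm x]

theorem gridFloor_eq {n : ℕ} {j : ℤ} {x : ℝ} (h : x ∈ gridCell n j) :
    gridFloor n x = (j : ℝ) / (n + 1) := by
  rw [gridCell, Set.mem_ofPred_eq] at h
  rw [gridFloor, h]

/-- The left endpoints of the cells that meet `[-C, C]`, multiplied by `n + 1`. -/
noncomputable def gridIndices (C : ℝ) (n : ℕ) : Finset ℤ :=
  Finset.Icc (-⌈C * (n + 1)⌉) ⌈C * (n + 1)⌉

theorem floor_mem_gridIndices {C x : ℝ} (h : |x| ≤ C) (n : ℕ) :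
    ⌊(n + 1 : ℝ) * x⌋ ∈ gridIndices C n := by
  have hn : (0 : ℝ) < n + 1 := by positivity
  have hx := abs_le.1 h
  have hC := Int.le_ceil (C * (n + 1 : ℝ))
  rw [gridIndices, Finset.mem_Icc]
  constructor
  · rw [Int.le_floor]
    push_cast
    nlinarith [hx.1]
  · rw [← Int.floor_intCast (R := ℝ) ⌈C * (n + 1 : ℝ)⌉]
    refine Int.floor_le_floor ?_
    nlinarith [hx.2]

theorem abs_div_le_of_mem_gridIndices {C : ℝ} {n : ℕ} {j : ℤ} (h : j ∈ gridIndices C n) :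
    |(j : ℝ) / (n + 1)| ≤ C + 1 := by
  have hn : (0 : ℝ) < n + 1 := by positivity
  have h1 : |(j : ℝ)| ≤ (⌈C * (n + 1 : ℝ)⌉ : ℝ) := by
    have := abs_le.2 (Finset.mem_Icc.1 h)
    exact_mod_cast this
  have h2 := Int.ceil_lt_add_one (C * (n + 1 : ℝ))
  rw [abs_div, abs_of_pos hn, div_le_iff₀ hn]
  nlinarith [n.cast_nonneg (α := ℝ)]

theorem integral_gridFloor_pow {m : Measure ℝ} [IsProbabilityMeasure m] {C : ℝ}
    (hm : ∀ᵐ x ∂m, |x| ≤ C) (n k : ℕ) :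
    ∫ x, gridFloor n x ^ k ∂m
      = ∑ j ∈ gridIndices C n, m.real (gridCell n j) * ((j : ℝ) / (n + 1)) ^ k := by
  have hmeas : ∀ j, MeasurableSet (gridCell n j) := fun j => by
    rw [gridCell_eq_Ico]
    exact measurableSet_Ico
  have h1 : ∫ x, gridFloor n x ^ k ∂m = ∫ x, ∑ j ∈ gridIndices C n,
      (gridCell n j).indicator (fun _ => ((j : ℝ) / (n + 1)) ^ k) x ∂m := by
    refine integral_congr_ae ?_
    filter_upwards [hm] with x hx
    rw [Finset.sum_eq_single_of_mem _ (floor_mem_gridIndices hx n),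
      Set.indicator_of_mem (show x ∈ gridCell n ⌊(n + 1 : ℝ) * x⌋ from rfl)]
    · rw [gridFloor]
    · intro j _ hj
      exact Set.indicator_of_notMem (fun h => hj h.symm) _
  rw [h1, integral_finsetSum]
  · refine Finset.sum_congr rfl fun j _ => ?_
    rw [integral_indicator_const _ (hmeas j), smul_eq_mul]
  · intro j _
    exact (integrable_const _).indicator (hmeas j)

theorem sum_measureReal_gridCell {m : Measure ℝ} [IsProbabilityMeasure m] {C : ℝ}
    (hm : ∀ᵐ x ∂m, |x| ≤ C) (n : ℕ) : ∑ j ∈ gridIndices C n, m.real (gridCell n j) = 1 := by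
  simpa using (integral_gridFloor_pow hm n 0).symm

/-- The density bound enters here: the mass of a cell can be rearranged as an interval of that
length inside the cell. -/
theorem measureReal_gridCell_le {m : Measure ℝ} (hm : m ≤ volume) (n : ℕ) (j : ℤ) :
    m.real (gridCell n j) ≤ 1 / (n + 1) := by
  have h : volume (gridCell n j) = ENNReal.ofReal (1 / (n + 1)) := by
    rw [gridCell_eq_Ico, Real.volume_Ico, add_sub_cancel_left]
  refine ENNReal.toReal_le_of_le_ofReal (by positivity) ?_
  exact (hm _).trans h.le

theorem div_add_le_div {n : ℕ} {i j : ℤ} (h : i < j) {p : ℝ} (hp : p ≤ 1 / (n + 1)) :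
    (i : ℝ) / (n + 1) + p ≤ (j : ℝ) / (n + 1) := by
  have h1 : (i : ℝ) + 1 ≤ j := by exact_mod_cast h
  calc _ ≤ (i : ℝ) / (n + 1) + 1 / (n + 1) := by gcongr
    _ = ((i : ℝ) + 1) / (n + 1) := by ring
    _ ≤ _ := by gcongr

end Grid

/-! ### Existence and surjectivity of the exponential transform. -/

section Transform

/-- Approximation of a measure with density at most `1` by the uniform measures on unions of
intervals. -/
theorem exists_expMomentIdentity_grid (ρ : BoundedDensityProb) {C : ℝ}
    (hC : ∀ᵐ x ∂ρ.1, |x| ≤ C) (n : ℕ) :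
    ∃ (ρ' : BoundedDensityProb) (ν : CompactProb), ExpMomentIdentity ρ'.toCompactProb ν ∧
      (∀ᵐ x ∂ρ'.1, |x| ≤ C + 2) ∧ (∀ᵐ x ∂ν.1, |x| ≤ C + 1) ∧
      ∀ k, ∫ x, gridFloor n x ^ k ∂ρ'.1 = ∫ x, gridFloor n x ^ k ∂ρ.1 := by
  have := ρ.2.1
  have hle : ρ.1 ≤ volume := hasDensityAtMostOne_iff.1 ρ.2.2.2
  let p : gridIndices C n → ℝ := fun j => ρ.1.real (gridCell n j)
  let y : gridIndices C n → ℝ := fun j => ((j : ℤ) : ℝ) / (n + 1)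
  have hn : (0 : ℝ) < n + 1 := by positivity
  have hp0 : ∀ j, 0 ≤ p j := fun j => measureReal_nonneg
  have hp1 : ∀ j, p j ≤ 1 / (n + 1) := fun j => measureReal_gridCell_le hle n j
  have hpsum : ∑ j, p j = 1 := by
    rw [← sum_measureReal_gridCell hC n]
    exact (Finset.sum_coe_sort (gridIndices C n) fun j => ρ.1.real (gridCell n j))
  have hne : Nonempty (gridIndices C n) := by
    by_contra h
    rw [not_nonempty_iff] at h
    simp at hpsum
  have hy : StrictMono y := fun i j hij => by
    have : ((i : ℤ) : ℝ) < ((j : ℤ) : ℝ) := by exact_mod_cast hij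
    exact div_lt_div_of_pos_right this hn
  have hyx : ∀ j, y j ≤ y j + p j := fun j => le_add_of_nonneg_right (hp0 j)
  have hxy : ∀ i j, i < j → y i + p i ≤ y j := fun i j hij => div_add_le_div hij (hp1 i)
  -- The mass p j is packed at the left end of its cell as [y j, y j + p j), so cell masses are
  -- preserved and intervals interlace. Empty cells only give w j = 0.
  obtain ⟨w, hw, hpf⟩ := exists_isPartialFraction_of_interlacing hy hyx hxy
  have hw1 : ∑ j, w j = 1 := by
    rw [← hpf.sum_eq, ← hpsum]
    simp
  obtain ⟨ρ', hρ', hexp⟩ := hpf.exists_expMomentIdentity hyx hxy hw hw1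
  have hyC : ∀ j, |y j| ≤ C + 1 := fun j => abs_div_le_of_mem_gridIndices j.2
  refine ⟨ρ', _, hexp, ?_, ae_discreteProb _ _ hyC, fun k => ?_⟩
  · rw [hρ']
    refine ae_restrict_iUnion_Ico_abs_le (fun j => ?_) fun j => ?_
    · linarith [(abs_le.1 (hyC j)).1]
    · have h1 : (1 : ℝ) / (n + 1) ≤ 1 := by
        rw [div_le_one hn]
        linarith [n.cast_nonneg (α := ℝ)]
      linarith [(abs_le.1 (hyC j)).2, hp1 j]
  · have hcell : ∀ j, ∀ t ∈ Set.Ico (y j) (y j + p j), gridFloor n t ^ k = y j ^ k := by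
      intro j t ht
      rw [gridFloor_eq (j := j)]
      rw [gridCell_eq_Ico]
      exact ⟨ht.1, ht.2.trans_le (add_le_add le_rfl (hp1 j))⟩
    rw [hρ', setIntegral_iUnion_Ico hxy, integral_gridFloor_pow hC,
      ← Finset.sum_coe_sort (gridIndices C n) fun j =>
        ρ.1.real (gridCell n j) * ((j : ℝ) / (n + 1)) ^ k]
    · refine Finset.sum_congr rfl fun j _ => ?_
      rw [setIntegral_congr_fun measurableSet_Ico (hcell j), setIntegral_const, smul_eq_mul,
        Real.volume_real_Ico_of_le (hyx j), add_sub_cancel_left]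
    · intro j
      refine (integrableOn_const (C := y j ^ k) (by simp)).congr_fun
        (fun t ht => (hcell j t ht).symm) measurableSet_Ico

/-- Rounding to the grid costs O(1/n) in each moment on both sides, and the rounded moments
coincide. -/
theorem tendsto_moment_of_gridFloor {m : ℕ → CompactProb} {m' : CompactProb} {C : ℝ}
    (hm : ∀ n, ∀ᵐ x ∂(m n).1, |x| ≤ C) (hm' : ∀ᵐ x ∂m'.1, |x| ≤ C)
    (h : ∀ n k, ∫ x, gridFloor n x ^ k ∂(m n).1 = ∫ x, gridFloor n x ^ k ∂m'.1) (k : ℕ) :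
    Tendsto (fun n => moment (m n) k) atTop (𝓝 (moment m' k)) := by
  have h1 := tendsto_integral_pow_sub_gridFloor hm k
  have h2 := tendsto_integral_pow_sub_gridFloor (m := fun _ => m') (fun _ => hm') k
  have h3 := (h1.sub h2).add_const (moment m' k)
  rw [sub_zero, zero_add] at h3
  refine h3.congr fun n => ?_
  rw [h]
  ring

/-- The exponential transform of a measure with density at most `1` is a probability measure. -/
theorem exists_expMomentIdentity (ρ : BoundedDensityProb) :
    ∃ ν, ExpMomentIdentity ρ.toCompactProb ν := by
  obtain ⟨C, hC⟩ := hasCompactSupp_iff.1 ρ.2.2.1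
  choose ρ' ν h1 h2 h3 h4 using exists_expMomentIdentity_grid ρ hC
  obtain ⟨φ, ν', hφ, -, h5, -⟩ := exists_subseq_tendsto_moment h3
  have h6 := tendsto_moment_of_gridFloor (m := fun n => (ρ' n).toCompactProb)
    (m' := ρ.toCompactProb) h2
    (by
      have hC' : ∀ᵐ x ∂ρ.1, |x| ≤ C + 2 := by
        filter_upwards [hC] with x hx
        linarith
      exact hC') h4
  exact ⟨ν', ExpMomentIdentity.of_tendsto (fun j => h1 (φ j))
    (fun k => (h6 k).comp hφ.tendsto_atTop) h5⟩

/-- Finitely supported measures are exponential transforms. -/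
theorem exists_expMomentIdentity_floor (ν : CompactProb) {C : ℝ}
    (hC : ∀ᵐ x ∂ν.1, |x| ≤ C) (n : ℕ) :
    ∃ (ρ : BoundedDensityProb) (ν' : CompactProb), ExpMomentIdentity ρ.toCompactProb ν' ∧
      (∀ᵐ x ∂ρ.1, |x| ≤ C + 2) ∧ ∀ k, moment ν' k = ∫ x, gridFloor n x ^ k ∂ν.1 := by
  -- Cells without mass are discarded because the construction of interlacing zeros needs strictly
  -- positive residues.
  let J := (gridIndices C n).filter fun j => 0 < ν.1.real (gridCell n j)
  have hn : (0 : ℝ) < n + 1 := by positivity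
  have hJ : ∀ k, ∑ j ∈ J, ν.1.real (gridCell n j) * ((j : ℝ) / (n + 1)) ^ k
      = ∫ x, gridFloor n x ^ k ∂ν.1 := by
    intro k
    rw [integral_gridFloor_pow hC]
    refine Finset.sum_subset (Finset.filter_subset _ _) fun j hj hj' => ?_
    have : ν.1.real (gridCell n j) = 0 := by
      refine le_antisymm (not_lt.1 fun h => hj' (Finset.mem_filter.2 ⟨hj, h⟩)) measureReal_nonneg
    rw [this, zero_mul]
  have hJ0 := hJ 0
  simp only [pow_zero, mul_one, integral_const, probReal_univ, smul_eq_mul] at hJ0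
  obtain ⟨N, hN⟩ : ∃ N, J.card = N + 1 := by
    refine Nat.exists_eq_succ_of_ne_zero fun h => ?_
    rw [Finset.card_eq_zero.1 h] at hJ0
    simp at hJ0
  let e := J.orderIsoOfFin hN
  let y : Fin (N + 1) → ℝ := fun i => ((e i : ℤ) : ℝ) / (n + 1)
  let w : Fin (N + 1) → ℝ := fun i => ν.1.real (gridCell n (e i))
  have hsum : ∀ k, ∑ i, w i * y i ^ k = ∫ x, gridFloor n x ^ k ∂ν.1 := by
    intro k
    rw [← hJ, ← Finset.sum_coe_sort J fun j =>
      ν.1.real (gridCell n j) * ((j : ℝ) / (n + 1)) ^ k]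
    exact e.toEquiv.sum_comp fun j : J =>
      ν.1.real (gridCell n j) * (((j : ℤ) : ℝ) / (n + 1)) ^ k
  have hy : StrictMono y := fun i j hij => by
    have : ((e i : ℤ) : ℝ) < ((e j : ℤ) : ℝ) := by exact_mod_cast e.strictMono hij
    exact div_lt_div_of_pos_right this hn
  have hw : ∀ i, 0 < w i := fun i => (Finset.mem_filter.1 (e i).2).2
  have hw1 : ∑ i, w i = 1 := by simpa using hsum 0
  have hyC : ∀ i, |y i| ≤ C + 1 := fun i =>
    abs_div_le_of_mem_gridIndices (Finset.mem_filter.1 (e i).2).1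
  obtain ⟨x, hyx, hxy, hx, hpf⟩ := exists_interlacing_isPartialFraction hy hw
  obtain ⟨ρ, hρ, hexp⟩ := hpf.exists_expMomentIdentity hyx hxy (fun i => (hw i).le) hw1
  refine ⟨ρ, _, hexp, ?_, fun k => ?_⟩
  · rw [hρ]
    refine ae_restrict_iUnion_Ico_abs_le (fun i => ?_) fun i => ?_
    · linarith [(abs_le.1 (hyC i)).1]
    -- The zeros exceed the last pole by at most the total mass, which is 1.
    · linarith [(abs_le.1 (hyC (Fin.last N))).2, hx i]
  · rw [moment_discreteProb, hsum]

/-- Every compactly supported probability measure is an exponential transform. -/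
theorem exists_boundedDensityProb_expMomentIdentity (ν : CompactProb) :
    ∃ ρ : BoundedDensityProb, ExpMomentIdentity ρ.toCompactProb ν := by
  obtain ⟨C, hC⟩ := hasCompactSupp_iff.1 ν.2.2
  choose ρ ν' h1 h2 h3 using exists_expMomentIdentity_floor ν hC
  obtain ⟨φ, ρ', hφ, -, h4, h5⟩ :=
    exists_subseq_tendsto_moment (m := fun n => (ρ n).toCompactProb) h2
  have hle : ρ'.1 ≤ volume := h5 fun n => by
    have := (ρ n).2.1
    exact hasDensityAtMostOne_iff.1 (ρ n).2.2.2
  have h6 : ∀ k, Tendsto (fun n => moment (ν' n) k) atTop (𝓝 (moment ν k)) := by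
    intro k
    have h := tendsto_integral_pow_sub_gridFloor (m := fun _ => ν) (fun _ => hC) k
    have h7 := (tendsto_const_nhds (x := moment ν k)).sub h
    rw [sub_zero] at h7
    refine h7.congr fun n => ?_
    rw [h3]
    ring
  refine ⟨⟨ρ'.1, ρ'.2.1, ρ'.2.2, hasDensityAtMostOne_iff.2 hle⟩, ?_⟩
  exact ExpMomentIdentity.of_tendsto (ρ' := ρ') (fun j => h1 (φ j)) h4
    fun k => (h6 k).comp hφ.tendsto_atTop

end Transform

/-- The last line is the intertwining property; the two lines before it say that both convolutions
in it are well defined. -/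
theorem theorem1p9 :
    ∃ Q : BoundedDensityProb → CompactProb,
      (∀ ρ : BoundedDensityProb, ExpMomentIdentity ρ.toCompactProb (Q ρ)) ∧
      ∀ ρ₁ ρ₂ : BoundedDensityProb,
        (∃! σ : BoundedDensityProb, IsQuantizedFreeConvolution ρ₁ ρ₂ σ) ∧
        (∃! τ : CompactProb, IsFreeConvolution (Q ρ₁) (Q ρ₂) τ) ∧
        freeConvolution (Q ρ₁) (Q ρ₂) = Q (quantizedFreeConvolution ρ₁ ρ₂) := by
  choose Q hQ using exists_expMomentIdentity
  refine ⟨Q, hQ, fun ρ₁ ρ₂ => ?_⟩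
  obtain ⟨τ, hτ⟩ := exists_isFreeConvolution (Q ρ₁) (Q ρ₂)
  -- Surjectivity of the exponential transform produces the quantized convolution: it is a preimage
  -- of the free convolution.
  obtain ⟨σ, hστ⟩ := exists_boundedDensityProb_expMomentIdentity τ
  have hσ : IsQuantizedFreeConvolution ρ₁ ρ₂ σ :=
    (isQuantizedFreeConvolution_iff_isFreeConvolution (hQ ρ₁) (hQ ρ₂) hστ).2 hτ
  have hfree : IsFreeConvolution (Q ρ₁) (Q ρ₂) (freeConvolution (Q ρ₁) (Q ρ₂)) :=
    Classical.epsilon_spec (p := IsFreeConvolution (Q ρ₁) (Q ρ₂)) ⟨τ, hτ⟩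
  have hquant : IsQuantizedFreeConvolution ρ₁ ρ₂ (quantizedFreeConvolution ρ₁ ρ₂) :=
    Classical.epsilon_spec (p := IsQuantizedFreeConvolution ρ₁ ρ₂) ⟨σ, hσ⟩
  refine ⟨⟨σ, hσ, fun σ' h => IsQuantizedFreeConvolution.unique h hσ⟩,
    ⟨τ, hτ, fun τ' h => IsFreeConvolution.unique h hτ⟩, hfree.unique ?_⟩
  exact (isQuantizedFreeConvolution_iff_isFreeConvolution (hQ ρ₁) (hQ ρ₂) (hQ _)).1 hquant
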